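/- Let $\mathbb{K}$ be a field and $q\in\mathbb{K}$. A simple oriented graph $G$ consists of a finite (possibly empty) set of vertices $V(G)$ and a set of edges, an edge being an ordered pair of distinct vertices; opposite edges $i\to j$, $j\to i$ may both be present. Graphs are considered up to isomorphism, and the empty graph is denoted by $1$. A cycle of $G$ is a sequence $(i_1,\dots,i_k)$ of $k\ge 2$ distinct vertices such that $i_1\to i_2\to\cdots\to i_k\to i_1$ are edges of $G$. An ideal of $G$ is a subset $A\subseteq V(G)$ such that $i\in A$ and $i\to j$ imply $j\in A$; $I(G)$ is the set of ideals, and $G_{\mid A}$ is the subgraph of $G$ induced on $A$. For graphs $G,H$, a subset $A\subseteq V(G)$ and an injection $\sigma:A\to V(H)$, let $G\sqcup_\sigma H$ be the simple oriented graph obtained from the disjoint union of $G$ and $H$ by identifying $x$ with $\sigma(x)$ for all $x\in A$, deleting any loops and replacing parallel edges by a single edge. Let $H_{\mathcal{SG}}$ (resp. $H_{\mathcal{NCSG}}$) be the vector space with basis the isomorphism classes of simple oriented graphs (resp. of simple oriented graphs with no cycle). (1) $H_{\mathcal{SG}}$ is a Hopf algebra, with $$G\cdot_q H=\sum_{A\subseteq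 V(G),\ \sigma:A\hookrightarrow V(H)} q^{|A|}\, G\sqcup_\sigma H,\qquad \Delta(G)=\sum_{A\in I(G)}G_{\mid V(G)\setminus A}\otimes G_{\mid A}.$$ (2) $H_{\mathcal{NCSG}}$ is a Hopf algebra, with, for all simple oriented graphs $G,H$ with no cycle, $$G\cdot_q H=\sum_{\substack{A\subseteq V(G),\ \sigma:A\hookrightarrow V(H),\\ G\sqcup_\sigma H\text{ with no cycle}}} q^{|A|}\, G\sqcup_\sigma H,\qquad \Delta(G)=\sum_{A\in I(G)}G_{\mid V(G)\setminus A}\otimes G_{\mid A}.$$ In both cases the unit is the empty graph, and the counit sends the empty graph to $1$ and every other graph to $0$. (3) The linear map $T:H_{\mathcal{SG}}\to H_{\mathcal{NCSG}}$ sending a graph $G$ to $G$ if $G$ has no cycle and to $0$ otherwise is a Hopf algebra morphism from $(H_{\mathcal{SG}},\cdot_q,\Delta)$ to $(H_{\mathcal{NCSG}},\cdot_q,\Delta)$. -/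

import Mathlib

open scoped TensorProduct

universe u

/-- A simple oriented graph: a finite set of vertices (possibly empty), at most one edge from a
vertex to another one, no loops. Two opposite edges `i → j` and `j → i` are allowed. -/
structure SimpleOrientedGraph : Type 1 where
  V : Type
  [fintypeV : Fintype V]
  graph : Digraph V
  loopless : ∀ v, ¬ graph.Adj v v

namespace SimpleOrientedGraph

attribute [instance] fintypeV

/-- Isomorphism of simple oriented graphs. -/
instance isoSetoid : Setoid SimpleOrientedGraph where
  r G H := Nonempty (G.graph.Adj ≃r H.graph.Adj)
  iseqv :=
    { refl := fun _ => ⟨RelIso.refl _⟩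
      symm := fun ⟨e⟩ => ⟨e.symm⟩
      trans := fun ⟨e⟩ ⟨f⟩ => ⟨e.trans f⟩ }

/-- `(c 0, …, c (k - 1))`, with `k = n + 2 ≥ 2`, is a sequence of distinct vertices, with edges
`c 0 → c 1 → ⋯ → c (k - 1) → c 0` (addition in `Fin k` is modulo `k`). -/
def IsCycle (G : SimpleOrientedGraph) {n : ℕ} (c : Fin (n + 2) → G.V) : Prop :=
  Function.Injective c ∧ ∀ i, G.graph.Adj (c i) (c (i + 1))

def NoCycle (G : SimpleOrientedGraph) : Prop :=
  ∀ (n : ℕ) (c : Fin (n + 2) → G.V), ¬ G.IsCycle c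

/-- The graph without vertices. -/
def empty : SimpleOrientedGraph where
  V := Empty
  graph := ⟨fun _ _ => False⟩
  loopless := fun _ h => h

/-- The restriction of `G` to a set `A` of vertices: all edges between two vertices of `A` are
kept, and nothing remains of the other edges. -/
def restrict (G : SimpleOrientedGraph) (A : Finset G.V) : SimpleOrientedGraph where
  V := A
  graph := ⟨fun v w => G.graph.Adj v w⟩
  loopless := fun v => G.loopless v

/-- Ideals: sets of vertices which are closed under following edges. -/
def IsIdeal (G : SimpleOrientedGraph) (A : Finset G.V) : Prop :=
  ∀ i j, i ∈ A → G.graph.Adj i j → j ∈ A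

/-- The equivalence on `V(G) ⊔ V(H)` which identifies each `x ∈ A ⊆ V(G)` with
`σ x ∈ V(H)`. -/
def glueSetoid (G H : SimpleOrientedGraph) {A : Finset G.V} (σ : A ↪ H.V) :
    Setoid (G.V ⊕ H.V) where
  r a b := a = b ∨ (∃ x : A, a = Sum.inl x.1 ∧ b = Sum.inr (σ x)) ∨
    (∃ x : A, b = Sum.inl x.1 ∧ a = Sum.inr (σ x))
  iseqv :=
    { refl := fun _ => Or.inl rfl
      symm := by
        rintro a b (h | h | h)
        · exact Or.inl h.symm
        · exact Or.inr (Or.inr h)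
        · exact Or.inr (Or.inl h)
      trans := by
        rintro a b c (h | ⟨x, hx, hx'⟩ | ⟨x, hx, hx'⟩) (h2 | ⟨y, hy, hy'⟩ | ⟨y, hy, hy'⟩)
        · exact Or.inl (h.trans h2)
        · exact Or.inr (Or.inl ⟨y, h.trans hy, hy'⟩)
        · exact Or.inr (Or.inr ⟨y, hy, h.trans hy'⟩)
        · exact Or.inr (Or.inl ⟨x, hx, h2.symm.trans hx'⟩)
        · exact nomatch hx'.symm.trans hy
        · have e := σ.injective (Sum.inr_injective (hx'.symm.trans hy'))
          exact Or.inl (by rw [hx, hy, e])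
        · exact Or.inr (Or.inr ⟨x, h2.symm.trans hx, hx'⟩)
        · have e := Subtype.ext (Sum.inl_injective (hx.symm.trans hy))
          exact Or.inl (by rw [hx', hy', e])
        · exact nomatch hx.symm.trans hy' }

/-- The canonical surjection from `V(G) ⊔ V(H)` to the vertices of the glued graph. -/
def glueProj (G H : SimpleOrientedGraph) {A : Finset G.V} (σ : A ↪ H.V) (a : G.V ⊕ H.V) :
    Quotient (glueSetoid G H σ) :=
  Quotient.mk _ a

open Classical in
/-- The simple oriented graph `S(G ⊔_σ H)`: the vertices of the disjoint union of `G` and `H` are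
identified along `σ`, the edges of `G` and of `H` are all kept, except that loops are deleted and
that parallel edges are replaced by one edge. -/
noncomputable def glue (G H : SimpleOrientedGraph) {A : Finset G.V} (σ : A ↪ H.V) :
    SimpleOrientedGraph where
  V := Quotient (glueSetoid G H σ)
  graph := ⟨fun u v => u ≠ v ∧
    ((∃ x y, G.graph.Adj x y ∧ glueProj G H σ (.inl x) = u ∧ glueProj G H σ (.inl y) = v) ∨
     (∃ x y, H.graph.Adj x y ∧ glueProj G H σ (.inr x) = u ∧ glueProj G H σ (.inr y) = v))⟩
  loopless := fun _ h => h.1 rfl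

theorem NoCycle.restrict {G : SimpleOrientedGraph} (hG : G.NoCycle) (A : Finset G.V) :
    (G.restrict A).NoCycle :=
  fun n c hc => hG n (fun i => (c i).1) ⟨fun _ _ h => hc.1 (Subtype.ext h), hc.2⟩

theorem NoCycle.of_iso {G H : SimpleOrientedGraph} (hG : G.NoCycle) (h : G ≈ H) : H.NoCycle := by
  obtain ⟨e⟩ := h
  exact fun n c hc => hG n (fun i => e.symm (c i))
    ⟨fun _ _ h => hc.1 (e.symm.injective h), fun i => e.symm.map_rel_iff.2 (hc.2 i)⟩

theorem noCycle_empty : empty.NoCycle := fun _ c _ => nomatch c 0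

end SimpleOrientedGraph

/-- Isoclasses of simple oriented graphs. -/
def SGClass : Type 1 := Quotient SimpleOrientedGraph.isoSetoid

/-- The property of isoclasses to have no cycle. -/
def SGClass.NoCycle (g : SGClass) : Prop :=
  Quotient.lift SimpleOrientedGraph.NoCycle
    (fun _ _ h => propext ⟨fun hG => hG.of_iso h, fun hH => hH.of_iso (Setoid.symm h)⟩) g

/-- Isoclasses of simple oriented graphs with no cycle. -/
def NCSGClass : Type 1 := {g : SGClass // g.NoCycle}

namespace SimpleOrientedGraph

/-- The isoclass of a simple oriented graph. -/
def cls (G : SimpleOrientedGraph) : SGClass := Quotient.mk _ G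

/-- The isoclass of a simple oriented graph with no cycle. -/
def ncCls (G : SimpleOrientedGraph) (hG : G.NoCycle) : NCSGClass := ⟨G.cls, hG⟩

end SimpleOrientedGraph

open SimpleOrientedGraph

open Classical in
/-- The Hopf algebra `A`, with basis `a` indexed by the isoclasses of simple oriented graphs, is
`(H_SG, ·_q, Δ)`: its unit is the empty graph, its counit is nonzero on the empty graph only,
and its product and its coproduct are given by the formulas `mul` and `comul`. -/
structure IsHSG {K A : Type*} [Field K] [Ring A] [HopfAlgebra K A] (q : K)
    (a : Module.Basis SGClass K A) : Prop where
  mul : ∀ G H : SimpleOrientedGraph,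
    a G.cls * a H.cls = ∑ U : Finset G.V, ∑ σ : U ↪ H.V, q ^ U.card • a (G.glue H σ).cls
  comul : ∀ G : SimpleOrientedGraph,
    Coalgebra.comul (R := K) (a G.cls) =
      ∑ U : Finset G.V with G.IsIdeal U, a (G.restrict Uᶜ).cls ⊗ₜ[K] a (G.restrict U).cls
  one : (1 : A) = a empty.cls
  counit : ∀ G : SimpleOrientedGraph,
    Coalgebra.counit (R := K) (a G.cls) = if IsEmpty G.V then 1 else 0

open Classical in
/-- The Hopf algebra `B`, with basis `b` indexed by the isoclasses of simple oriented graphs with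
no cycle, is `(H_NCSG, ·_q, Δ)`. In the product, the sum is restricted to the injections `σ` such
that the glued graph has no cycle. -/
structure IsHNCSG {K B : Type*} [Field K] [Ring B] [HopfAlgebra K B] (q : K)
    (b : Module.Basis NCSGClass K B) : Prop where
  mul : ∀ (G H : SimpleOrientedGraph) (hG : G.NoCycle) (hH : H.NoCycle),
    b (G.ncCls hG) * b (H.ncCls hH) = ∑ U : Finset G.V, ∑ σ : U ↪ H.V,
      if h : (G.glue H σ).NoCycle then q ^ U.card • b ((G.glue H σ).ncCls h) else 0
  comul : ∀ (G : SimpleOrientedGraph) (hG : G.NoCycle),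
    Coalgebra.comul (R := K) (b (G.ncCls hG)) =
      ∑ U : Finset G.V with G.IsIdeal U,
        b ((G.restrict Uᶜ).ncCls (hG.restrict Uᶜ)) ⊗ₜ[K] b ((G.restrict U).ncCls (hG.restrict U))
  one : (1 : B) = b (empty.ncCls noCycle_empty)
  counit : ∀ (G : SimpleOrientedGraph) (hG : G.NoCycle),
    Coalgebra.counit (R := K) (b (G.ncCls hG)) = if IsEmpty G.V then 1 else 0

/-! A pair `(A, σ)` is the same as an equivalence relation on `V(G) ⊔ V(H)` that merges no two
distinct vertices of `G` and no two of `H`; `|A|` is the number of vertices lost in the quotient. A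
`MergeGraph` is a digraph `P` with a relation saying which pairs must not be merged, and `merges q
P` is the sum, over the allowed equivalences `s`, of `P/s` weighted by `q` to the number of vertices
lost. Graphs with all pairs separated give the basis, and disjoint unions of two of them give the
products.

The product then becomes disjoint union (`merges_mul_merges`): an allowed equivalence on `P ⊔ Q`
amounts to its traces `s`, `s'` on `P` and `Q` together with a gluing of `P/s` to `Q/s'`.
Associativity and commutativity come from those of `⊔`.

The coproduct of `merges q P` is the sum of all cuts of `P` along ideals (`comulLin_merges`): an
ideal of `P/s` is an ideal of `P` saturated for `s`, and an equivalence saturating `J` is a pair of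
equivalences, on `J` and on its complement. Since the ideals of `P ⊔ Q` are pairs of ideals, the
coproduct is multiplicative. Coassociativity counts nested pairs of ideals. The antipode is the
geometric series in `ηε - id` for convolution, finite on each graph.

For the acyclic case, a graph with a cycle keeps one after any gluing, and a cycle is never cut by
an ideal. Hence the graphs with a cycle span a Hopf ideal; the quotient has the acyclic graphs as a
basis, the required structure maps, and the projection onto it is `T`. -/

open Classical in
noncomputable instance Setoid.instFintype {X : Type*} [Fintype X] : Fintype (Setoid X) :=
  Fintype.ofInjective (fun s : Setoid X => fun p : X × X => s p.1 p.2) fun _ _ h =>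
    Setoid.ext fun a b => iff_of_eq (congrFun h (a, b))

/-! ### Merging vertices of digraphs -/

/-- A finite directed graph (loops allowed) with a relation `sep` prescribing which pairs of
distinct vertices may not be merged. -/
structure MergeGraph : Type 1 where
  V : Type
  [fintypeV : Fintype V]
  adj : V → V → Prop
  sep : V → V → Prop

namespace MergeGraph

attribute [instance] fintypeV

/-- The equivalences on the vertices that do not merge separated vertices. -/
def IsMerge (P : MergeGraph) (s : Setoid P.V) : Prop :=
  ∀ x y, P.sep x y → s x y → x = y

open Classical in
/-- The simple oriented graph obtained by merging equivalent vertices, and deleting loops and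
multiple edges. -/
noncomputable def quot (P : MergeGraph) (s : Setoid P.V) : SimpleOrientedGraph where
  V := Quotient s
  graph := ⟨fun u v => u ≠ v ∧
    ∃ x y, P.adj x y ∧ (Quotient.mk s x : Quotient s) = u ∧ (Quotient.mk s y : Quotient s) = v⟩
  loopless := fun _ h => h.1 rfl

/-- The canonical projection onto the vertices of the merged graph. -/
def proj (P : MergeGraph) (s : Setoid P.V) (x : P.V) : (P.quot s).V := Quotient.mk s x

theorem proj_surjective (P : MergeGraph) (s : Setoid P.V) : Function.Surjective (P.proj s) :=
  Quotient.mk_surjective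

theorem proj_eq_iff (P : MergeGraph) (s : Setoid P.V) (x y : P.V) :
    P.proj s x = P.proj s y ↔ s x y :=
  Quotient.eq

theorem quot_adj (P : MergeGraph) (s : Setoid P.V) (u v : (P.quot s).V) :
    (P.quot s).graph.Adj u v ↔ u ≠ v ∧ ∃ x y, P.adj x y ∧ P.proj s x = u ∧ P.proj s y = v :=
  Iff.rfl

theorem quot_adj_proj (P : MergeGraph) (s : Setoid P.V) {x y : P.V} (h : P.adj x y)
    (hs : ¬ s x y) : (P.quot s).graph.Adj (P.proj s x) (P.proj s y) :=
  ⟨fun e => hs ((P.proj_eq_iff s x y).1 e), x, y, h, rfl, rfl⟩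

/-- Disjoint union, where vertices of different components may be merged. -/
abbrev sum (P Q : MergeGraph) : MergeGraph where
  V := P.V ⊕ Q.V
  adj := Sum.LiftRel P.adj Q.adj
  sep := Sum.LiftRel P.sep Q.sep

open Classical in
/-- The induced subgraph on a set of vertices. -/
noncomputable abbrev sub (P : MergeGraph) (J : Set P.V) : MergeGraph where
  V := J
  adj x y := P.adj x y
  sep x y := P.sep x y

/-- Sets of vertices closed under following edges. -/
def IsIdeal (P : MergeGraph) (J : Set P.V) : Prop :=
  ∀ i j, i ∈ J → P.adj i j → j ∈ J

/-- Recognition criterion by which every merged graph below is identified with a concrete one. -/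
theorem cls_quot_eq (P : MergeGraph) (s : Setoid P.V) (H : SimpleOrientedGraph) (f : P.V → H.V)
    (hf : Function.Surjective f) (hs : ∀ x y, f x = f y ↔ s x y)
    (hadj : ∀ u v, H.graph.Adj u v ↔ u ≠ v ∧ ∃ x y, P.adj x y ∧ f x = u ∧ f y = v) :
    (P.quot s).cls = H.cls := by
  let e : (P.quot s).V → H.V := Quotient.lift f fun x y h => (hs x y).2 h
  have he : Function.Bijective e := by
    refine ⟨?_, fun y => ?_⟩
    · rintro ⟨x⟩ ⟨y⟩ h
      exact Quotient.sound ((hs x y).1 h)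
    · obtain ⟨x, rfl⟩ := hf y
      exact ⟨P.proj s x, rfl⟩
  refine Quotient.sound ⟨⟨Equiv.ofBijective e he, ?_⟩⟩
  rintro u v
  rw [Equiv.ofBijective_apply, Equiv.ofBijective_apply, hadj, he.1.ne_iff, quot_adj]
  refine and_congr_right fun _ => ⟨?_, ?_⟩
  · rintro ⟨x, y, h, hx, hy⟩
    exact ⟨x, y, h, he.1 hx, he.1 hy⟩
  · rintro ⟨x, y, h, rfl, rfl⟩
    exact ⟨x, y, h, rfl, rfl⟩

end MergeGraph

namespace SimpleOrientedGraph

/-- A simple oriented graph, none of whose vertices may be merged. -/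
abbrev rigid (G : SimpleOrientedGraph) : MergeGraph where
  V := G.V
  adj := G.graph.Adj
  sep _ _ := True

open Classical in
/-- The induced subgraph on a set of vertices. -/
noncomputable abbrev sub (G : SimpleOrientedGraph) (J : Set G.V) : SimpleOrientedGraph where
  V := J
  graph := ⟨fun x y => G.graph.Adj x y⟩
  loopless x := G.loopless x

end SimpleOrientedGraph

/-! ### The underlying space and the product -/

/-- The vector space with basis the isoclasses of simple oriented graphs, for the
`q`-deformed product. -/
def HSG (K : Type u) [Field K] (_q : K) : Type (max 1 u) := SGClass →₀ K

namespace HSG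

variable {K : Type u} [Field K] (q : K)

noncomputable instance : AddCommGroup (HSG K q) := inferInstanceAs (AddCommGroup (SGClass →₀ K))
noncomputable instance : Module K (HSG K q) := inferInstanceAs (Module K (SGClass →₀ K))

/-- The basis of isoclasses. -/
noncomputable def basis : Module.Basis SGClass K (HSG K q) := ⟨LinearEquiv.refl K (SGClass →₀ K)⟩

open Classical in
/-- The weighted sum over all ways of merging vertices. -/
noncomputable def merges (P : MergeGraph) : HSG K q :=
  ∑ s : Setoid P.V with P.IsMerge s,
    q ^ (Nat.card P.V - Nat.card (Quotient s)) • basis q (P.quot s).cls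

open Classical in
theorem merges_congr {P Q : MergeGraph} (e : P.V ≃ Q.V)
    (hadj : ∀ x y, Q.adj (e x) (e y) ↔ P.adj x y) (hsep : ∀ x y, Q.sep (e x) (e y) ↔ P.sep x y) :
    merges q P = merges q Q := by
  have hsymm : ∀ (t : Setoid P.V) (x y : P.V), t.comap e.symm (e x) (e y) ↔ t x y := by
    intro t x y
    rw [Setoid.comap_rel]; simp
  refine Finset.sum_bij' (fun s _ => s.comap e.symm) (fun t _ => t.comap e) ?_ ?_ ?_ ?_ ?_
  · intro s hs
    simp only [Finset.mem_filter, Finset.mem_univ, true_and] at hs ⊢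
    intro x y h1 h2
    obtain ⟨x, rfl⟩ := e.surjective x
    obtain ⟨y, rfl⟩ := e.surjective y
    rw [hsymm] at h2
    rw [hs x y ((hsep x y).1 h1) h2]
  · intro t ht
    simp only [Finset.mem_filter, Finset.mem_univ, true_and] at ht ⊢
    intro x y h1 h2
    exact e.injective (ht _ _ ((hsep x y).2 h1) h2)
  · intro s _
    ext x y
    exact hsymm s x y
  · intro t _
    ext x y
    simp [Setoid.comap_rel]
  · intro s _
    have hq : Nat.card (Quotient s) = Nat.card (Quotient (s.comap e.symm)) :=
      Nat.card_congr (Quotient.congr e fun x y => (hsymm s x y).symm)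
    rw [← hq, Nat.card_congr e]
    congr 2
    refine MergeGraph.cls_quot_eq P s _ (fun x => Q.proj _ (e x))
      ((Q.proj_surjective _).comp e.surjective) ?_ ?_
    · intro x y
      rw [Q.proj_eq_iff]
      exact hsymm s x y
    · intro u v
      rw [Q.quot_adj]
      refine and_congr_right fun _ => ⟨?_, ?_⟩
      · rintro ⟨x, y, h, rfl, rfl⟩
        exact ⟨e.symm x, e.symm y, (hadj _ _).1 (by simpa using h), by simp, by simp⟩
      · rintro ⟨x, y, h, rfl, rfl⟩
        exact ⟨e x, e y, (hadj _ _).2 h, rfl, rfl⟩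

/-- All pairs being separated, equality is the only allowed equivalence. This lets basis elements
enter computations with `merges`. -/
theorem merges_rigid (G : SimpleOrientedGraph) : merges q G.rigid = basis q G.cls := by
  classical
  have h : (Finset.univ.filter fun s => G.rigid.IsMerge s) = {⊥} := by
    ext s
    simp only [Finset.mem_filter, Finset.mem_univ, true_and, Finset.mem_singleton]
    refine ⟨fun hs => ?_, ?_⟩
    · ext x y
      exact ⟨fun h => hs x y trivial h, fun h => by cases h; exact s.refl x⟩
    · rintro rfl x y _ h
      exact h
  rw [merges]
  simp only [h, Finset.sum_singleton]
  rw [MergeGraph.cls_quot_eq G.rigid ⊥ G id Function.surjective_id (fun x y => Iff.rfl)]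
  · have : Nat.card (Quotient (⊥ : Setoid G.rigid.V)) = Nat.card G.rigid.V :=
      (Nat.card_congr (Equiv.ofBijective (Quotient.mk (⊥ : Setoid G.rigid.V))
        ⟨fun x y h => Quotient.exact h, Quotient.mk_surjective⟩)).symm
    rw [this]
    simp
  · intro u v
    refine ⟨fun h => ⟨?_, u, v, h, rfl, rfl⟩, ?_⟩
    · rintro rfl
      exact G.loopless _ h
    · rintro ⟨_, x, y, h, rfl, rfl⟩
      exact h

theorem merges_rigid_congr {P : MergeGraph} (G : SimpleOrientedGraph) (e : P.V ≃ G.V)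
    (hadj : ∀ x y, G.graph.Adj (e x) (e y) ↔ P.adj x y) (hsep : ∀ x y, P.sep x y) :
    merges q P = basis q G.cls := by
  rw [← merges_rigid]
  exact merges_congr q (Q := G.rigid) e hadj fun x y => ⟨fun _ => hsep x y, fun _ => trivial⟩

/-- The product. -/
noncomputable def mulLin : HSG K q →ₗ[K] HSG K q →ₗ[K] HSG K q :=
  (basis q).constr K fun g => (basis q).constr K fun h =>
    merges q (g.out.rigid.sum h.out.rigid)

noncomputable instance : Mul (HSG K q) := ⟨fun x y => mulLin q x y⟩

theorem mul_def (x y : HSG K q) : x * y = mulLin q x y := rfl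

theorem exists_iso_out (G : SimpleOrientedGraph) :
    Nonempty (G.graph.Adj ≃r (Quotient.out G.cls).graph.Adj) :=
  Setoid.symm (Quotient.mk_out G)

/-- The product is defined on chosen representatives; invariance of `merges` under isomorphism
allows any others. -/
theorem basis_mul_basis (G H : SimpleOrientedGraph) :
    basis q G.cls * basis q H.cls = merges q (G.rigid.sum H.rigid) := by
  rw [mul_def, mulLin, Module.Basis.constr_basis, Module.Basis.constr_basis]
  obtain ⟨e⟩ := exists_iso_out G
  obtain ⟨f⟩ := exists_iso_out H
  symm
  refine merges_congr q (Equiv.sumCongr e.toEquiv f.toEquiv) ?_ ?_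
  · rintro (x | x) (y | y)
    · simpa using e.map_rel_iff
    · simp
    · simp
    · simpa using f.map_rel_iff
  · rintro (x | x) (y | y) <;> simp

end HSG

/-! ### Merging a disjoint union in two stages -/

namespace MergeGraph

theorem card_quot (P : MergeGraph) (s : Setoid P.V) :
    Nat.card (Quotient s) = Nat.card (P.quot s).V := rfl

theorem card_quot_le (P : MergeGraph) (s : Setoid P.V) :
    Nat.card (P.quot s).V ≤ Nat.card P.V :=
  Nat.card_le_card_of_surjective _ (P.proj_surjective s)

section Sum

variable {P Q : MergeGraph} (s : Setoid P.V) (s' : Setoid Q.V)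

/-- Two graphs, each of which has already been merged. -/
noncomputable abbrev quotSum : MergeGraph := (P.quot s).rigid.sum (Q.quot s').rigid

/-- The projection merging both summands. -/
def projSum : (P.sum Q).V → (quotSum s s').V := Sum.map (P.proj s) (Q.proj s')

theorem projSum_surjective : Function.Surjective (projSum s s') :=
  Sum.map_surjective.2 ⟨P.proj_surjective s, Q.proj_surjective s'⟩

theorem projSum_eq_iff {u : Setoid (P.sum Q).V} (h : u.comap Sum.inl = s)
    (h' : u.comap Sum.inr = s') {x y : (P.sum Q).V} (hxy : projSum s s' x = projSum s s' y) :
    u x y := by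
  subst h h'
  rcases x with x | x <;> rcases y with y | y
  · exact (P.proj_eq_iff _ x y).1 (Sum.inl_injective hxy)
  · exact nomatch hxy
  · exact nomatch hxy
  · exact (Q.proj_eq_iff _ x y).1 (Sum.inr_injective hxy)

/-- An edge deleted as a loop in the first stage would be a loop in the final quotient too, so
deleting loops in stages or all at once gives the same edges between distinct vertices. -/
theorem exists_adj_projSum_iff (t : Setoid (quotSum s s').V) (u v : ((quotSum s s').quot t).V)
    (huv : u ≠ v) :
    (∃ x y, (quotSum s s').adj x y ∧ (quotSum s s').proj t x = u ∧ (quotSum s s').proj t y = v) ↔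
    ∃ x y, (P.sum Q).adj x y ∧ (quotSum s s').proj t (projSum s s' x) = u ∧
      (quotSum s s').proj t (projSum s s' y) = v := by
  constructor
  · rintro ⟨x, y, h, rfl, rfl⟩
    rcases h with h | h
    · obtain ⟨_, x, y, h, rfl, rfl⟩ := h
      exact ⟨.inl x, .inl y, .inl h, rfl, rfl⟩
    · obtain ⟨_, x, y, h, rfl, rfl⟩ := h
      exact ⟨.inr x, .inr y, .inr h, rfl, rfl⟩
  · rintro ⟨x, y, h, rfl, rfl⟩
    refine ⟨_, _, ?_, rfl, rfl⟩
    rcases h with h | h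
    · exact .inl (P.quot_adj_proj s h fun e => huv (by
        rw [projSum, Sum.map_inl, Sum.map_inl, (P.proj_eq_iff s _ _).2 e]))
    · exact .inr (Q.quot_adj_proj s' h fun e => huv (by
        rw [projSum, Sum.map_inr, Sum.map_inr, (Q.proj_eq_iff s' _ _).2 e]))

theorem cls_quot_projSum (t : Setoid (quotSum s s').V) :
    ((P.sum Q).quot (t.comap (projSum s s'))).cls = ((quotSum s s').quot t).cls := by
  refine cls_quot_eq _ _ _ (fun x => (quotSum s s').proj t (projSum s s' x))
    (((quotSum s s').proj_surjective t).comp (projSum_surjective s s')) ?_ ?_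
  · intro x y
    exact (quotSum s s').proj_eq_iff t _ _
  · intro u v
    rw [quot_adj]
    exact and_congr_right fun h => exists_adj_projSum_iff s s' t u v h

theorem card_quot_projSum (t : Setoid (quotSum s s').V) :
    Nat.card (Quotient (t.comap (projSum s s'))) = Nat.card (Quotient t) := by
  refine Nat.card_congr (Equiv.ofBijective
    (Quotient.lift (fun x => (Quotient.mk t (projSum s s' x) : Quotient t))
      fun x y h => Quotient.sound h) ⟨?_, ?_⟩)
  · rintro ⟨x⟩ ⟨y⟩ h
    exact Quotient.sound (Quotient.exact h : t _ _)
  · rintro ⟨y⟩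
    obtain ⟨x, rfl⟩ := projSum_surjective s s' y
    exact ⟨Quotient.mk _ x, rfl⟩

variable {s s'}

theorem IsMerge.comap_projSum (hs : P.IsMerge s) (hs' : Q.IsMerge s')
    {t : Setoid (quotSum s s').V} (ht : (quotSum s s').IsMerge t) :
    (P.sum Q).IsMerge (t.comap (projSum s s')) := by
  rintro _ _ (h | h) hxy
  · exact congrArg _ (hs _ _ h ((P.proj_eq_iff s _ _).1
      (Sum.inl_injective (ht _ _ (.inl trivial) hxy))))
  · exact congrArg _ (hs' _ _ h ((Q.proj_eq_iff s' _ _).1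
      (Sum.inr_injective (ht _ _ (.inr trivial) hxy))))

/-- The second stage identifies no further vertices of `P/s`, so the trace on `P` is exactly the
first stage. -/
theorem IsMerge.comap_projSum_inl {t : Setoid (quotSum s s').V} (ht : (quotSum s s').IsMerge t) :
    (t.comap (projSum s s')).comap Sum.inl = s := by
  ext x y
  refine ⟨fun h => (P.proj_eq_iff s _ _).1 (Sum.inl_injective (ht _ _ (.inl trivial) h)),
    fun h => ?_⟩
  have e := (P.proj_eq_iff s _ _).2 h
  simp only [Setoid.comap_rel, projSum, Sum.map_inl, e]
  exact t.refl _

theorem IsMerge.comap_projSum_inr {t : Setoid (quotSum s s').V} (ht : (quotSum s s').IsMerge t) :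
    (t.comap (projSum s s')).comap Sum.inr = s' := by
  ext x y
  refine ⟨fun h => (Q.proj_eq_iff s' _ _).1 (Sum.inr_injective (ht _ _ (.inr trivial) h)),
    fun h => ?_⟩
  have e := (Q.proj_eq_iff s' _ _).2 h
  simp only [Setoid.comap_rel, projSum, Sum.map_inr, e]
  exact t.refl _

theorem IsMerge.exists_comap_projSum {u : Setoid (P.sum Q).V} (hu : u.comap Sum.inl = s)
    (hu' : u.comap Sum.inr = s') :
    ∃ t : Setoid (quotSum s s').V, (quotSum s s').IsMerge t ∧ t.comap (projSum s s') = u := by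
  have hsec := Function.surjInv_eq (projSum_surjective s s')
  have key : ∀ x, u (Function.surjInv (projSum_surjective s s') (projSum s s' x)) x :=
    fun x => projSum_eq_iff s s' hu hu' (hsec _)
  -- The second stage is `u` read through a section of `projSum`; by `key`, moving a vertex to the
  -- chosen one in its fibre stays within its `u`-class.
  refine ⟨u.comap (Function.surjInv (projSum_surjective s s')), ?_, ?_⟩
  · have aux : ∀ x y : (P.sum Q).V, (quotSum s s').sep (projSum s s' x) (projSum s s' y) →
        u x y → projSum s s' x = projSum s s' y := by
      subst hu hu'
      rintro (x | x) (y | y) hsep h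
      · exact congrArg Sum.inl ((P.proj_eq_iff _ _ _).2 h)
      · exact nomatch hsep
      · exact nomatch hsep
      · exact congrArg Sum.inr ((Q.proj_eq_iff _ _ _).2 h)
    intro x y hsep h
    have := aux _ _ (by rwa [hsec, hsec]) (Setoid.comap_rel _ _ _ _ |>.1 h)
    rwa [hsec, hsec] at this
  · ext x y
    rw [Setoid.comap_rel, Setoid.comap_rel]
    exact ⟨fun h => u.trans (u.symm (key x)) (u.trans h (key y)),
      fun h => u.trans (key x) (u.trans h (u.symm (key y)))⟩

end Sum

end MergeGraph

/-! ### The commutative algebra structure -/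

namespace HSG

open MergeGraph

variable {K : Type u} [Field K] (q : K)

open Classical in
-- Equivalences on the disjoint union are grouped by their traces `(s, s')`; those with given traces
-- are the pullbacks of the allowed equivalences on `P/s ⊔ Q/s'`.
theorem merges_mul_merges (P Q : MergeGraph) :
    merges q P * merges q Q = merges q (P.sum Q) := by
  have hmul : merges q P * merges q Q =
      ∑ s : Setoid P.V with P.IsMerge s, ∑ s' : Setoid Q.V with Q.IsMerge s',
        ∑ t : Setoid (quotSum s s').V with (quotSum s s').IsMerge t,
          q ^ (Nat.card P.V + Nat.card Q.V - Nat.card (Quotient t)) •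
            basis q ((quotSum s s').quot t).cls := by
    rw [merges, merges, mul_def]
    simp only [map_sum, LinearMap.sum_apply, map_smul, LinearMap.smul_apply, ← mul_def,
      basis_mul_basis, Finset.smul_sum]
    rw [Finset.sum_comm]
    refine Finset.sum_congr rfl fun s _ => Finset.sum_congr rfl fun s' _ => ?_
    rw [merges, Finset.smul_sum, Finset.smul_sum]
    refine Finset.sum_congr rfl fun t _ => ?_
    rw [smul_smul, smul_smul, ← pow_add, ← pow_add]
    congr 2
    -- Subtraction is truncated: these bounds are what lets the losses of the two stages add up.
    have h1 := P.card_quot_le s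
    have h2 := Q.card_quot_le s'
    have h3 := ((P.quot s).rigid.sum (Q.quot s').rigid).card_quot_le t
    have h4 : Nat.card ((P.quot s).rigid.sum (Q.quot s').rigid).V =
      Nat.card (P.quot s).V + Nat.card (Q.quot s').V :=
      Nat.card_sum
    rw [card_quot, card_quot, card_quot]
    omega
  rw [hmul, ← Finset.sum_product', merges,
    ← Finset.sum_fiberwise_of_maps_to
      (g := fun u : Setoid (P.sum Q).V => (u.comap Sum.inl, u.comap Sum.inr))
      (t := (Finset.univ.filter fun s => P.IsMerge s) ×ˢ
        (Finset.univ.filter fun s' => Q.IsMerge s'))]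
  · refine Finset.sum_congr rfl ?_
    rintro ⟨s, s'⟩ hs
    simp only [Finset.mem_product, Finset.mem_filter, Finset.mem_univ, true_and] at hs
    refine Finset.sum_bij (fun t _ => t.comap (projSum s s')) ?_ ?_ ?_ ?_
    · intro t ht
      simp only [Finset.mem_filter, Finset.mem_univ, true_and] at ht ⊢
      exact ⟨IsMerge.comap_projSum hs.1 hs.2 ht, Prod.ext ht.comap_projSum_inl ht.comap_projSum_inr⟩
    · intro t _ t' _ h
      ext x y
      obtain ⟨x, rfl⟩ := projSum_surjective s s' x
      obtain ⟨y, rfl⟩ := projSum_surjective s s' y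
      exact Setoid.ext_iff.1 h x y
    · intro u hu
      simp only [Finset.mem_filter, Finset.mem_univ, true_and, Prod.mk.injEq] at hu
      obtain ⟨t, ht, rfl⟩ := IsMerge.exists_comap_projSum hu.2.1 hu.2.2
      exact ⟨t, by simpa using ht, rfl⟩
    · intro t _
      have h : Nat.card (P.sum Q).V = Nat.card P.V + Nat.card Q.V := Nat.card_sum
      rw [cls_quot_projSum, card_quot_projSum, h]
  · intro u hu
    simp only [Finset.mem_filter, Finset.mem_univ, true_and, Finset.mem_product] at hu ⊢
    exact ⟨fun x y h h' => Sum.inl_injective (hu _ _ (.inl h) h'),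
      fun x y h h' => Sum.inr_injective (hu _ _ (.inr h) h')⟩

theorem merges_sum_assoc (P Q R : MergeGraph) :
    merges q ((P.sum Q).sum R) = merges q (P.sum (Q.sum R)) :=
  merges_congr q (Equiv.sumAssoc P.V Q.V R.V)
    (by rintro ((x | x) | x) ((y | y) | y) <;> simp)
    (by rintro ((x | x) | x) ((y | y) | y) <;> simp)

theorem merges_sum_comm (P Q : MergeGraph) : merges q (P.sum Q) = merges q (Q.sum P) :=
  merges_congr q (Equiv.sumComm P.V Q.V)
    (by rintro (x | x) (y | y) <;> simp) (by rintro (x | x) (y | y) <;> simp)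

noncomputable instance : One (HSG K q) := ⟨basis q empty.cls⟩

theorem one_def : (1 : HSG K q) = basis q empty.cls := rfl

@[elab_as_elim]
theorem induction_basis {p : HSG K q → Prop} (x : HSG K q) (h0 : p 0)
    (hadd : ∀ x y, p x → p y → p (x + y)) (hsmul : ∀ (c : K) x, p x → p (c • x))
    (hb : ∀ G : SimpleOrientedGraph, p (basis q G.cls)) : p x := by
  have hx : x ∈ Submodule.span K (Set.range (basis q)) := by
    rw [(basis q).span_eq]; trivial
  induction hx using Submodule.span_induction with
  | mem x h =>
    obtain ⟨g, rfl⟩ := h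
    obtain ⟨G, rfl⟩ := Quotient.exists_rep g
    exact hb G
  | zero => exact h0
  | add x y _ _ hx hy => exact hadd x y hx hy
  | smul c x _ hx => exact hsmul c x hx

theorem linearMap_ext {M : Type*} [AddCommMonoid M] [Module K M] {f g : HSG K q →ₗ[K] M}
    (h : ∀ G : SimpleOrientedGraph, f (basis q G.cls) = g (basis q G.cls)) : f = g :=
  (basis q).ext fun c => by obtain ⟨G, rfl⟩ := Quotient.exists_rep c; exact h G

theorem mul_comm' (x y : HSG K q) : x * y = y * x := by
  have : mulLin q = (mulLin q).flip := by
    refine linearMap_ext q fun G => linearMap_ext q fun H => ?_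
    rw [LinearMap.flip_apply, ← mul_def, ← mul_def, basis_mul_basis, basis_mul_basis,
      merges_sum_comm]
  rw [mul_def, this, LinearMap.flip_apply, mul_def]

theorem mul_assoc' (x y z : HSG K q) : x * y * z = x * (y * z) := by
  induction x using induction_basis with
  | h0 => simp [mul_def]
  | hadd x x' h h' => simp only [mul_def, map_add, LinearMap.add_apply] at *; rw [h, h']
  | hsmul c x h => simp only [mul_def, map_smul, LinearMap.smul_apply] at *; rw [h]
  | hb G =>
  induction y using induction_basis with
  | h0 => simp [mul_def]
  | hadd x x' h h' => simp only [mul_def, map_add, LinearMap.add_apply] at *; rw [h, h']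
  | hsmul c x h => simp only [mul_def, map_smul, LinearMap.smul_apply] at *; rw [h]
  | hb H =>
  induction z using induction_basis with
  | h0 => simp [mul_def]
  | hadd x x' h h' => simp only [mul_def, map_add] at *; rw [h, h']
  | hsmul c x h => simp only [mul_def, map_smul] at *; rw [h]
  | hb L =>
  -- Seen as `merges` of rigid graphs, both products become `merges` of a triple disjoint union.
  rw [← merges_rigid, ← merges_rigid, ← merges_rigid]
  simp only [merges_mul_merges, merges_sum_assoc]

theorem one_mul' (x : HSG K q) : 1 * x = x := by
  have : mulLin q 1 = LinearMap.id := by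
    refine linearMap_ext q fun G => ?_
    rw [← mul_def, one_def, basis_mul_basis]
    refine merges_rigid_congr q G (Equiv.emptySum Empty G.V) ?_ ?_
    · rintro (x | x) (y | y)
      · exact nomatch x
      · exact nomatch x
      · exact nomatch y
      · exact Sum.liftRel_inr_inr.symm
    · rintro (x | x) (y | y)
      · exact nomatch x
      · exact nomatch x
      · exact nomatch y
      · simp
  rw [mul_def, this, LinearMap.id_apply]

noncomputable instance : CommRing (HSG K q) where
  __ := (inferInstance : AddCommGroup (HSG K q))
  mul_assoc := mul_assoc' q
  mul_comm := mul_comm' q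
  one_mul := one_mul' q
  mul_one x := by rw [mul_comm', one_mul']
  left_distrib x y z := by simp only [mul_def, map_add]
  right_distrib x y z := by simp only [mul_def, map_add, LinearMap.add_apply]
  zero_mul x := by simp only [mul_def, map_zero, LinearMap.zero_apply]
  mul_zero x := by simp only [mul_def, map_zero]

noncomputable instance : Algebra K (HSG K q) :=
  Algebra.ofModule (fun c x y => by simp only [mul_def, map_smul, LinearMap.smul_apply])
    (fun c x y => by simp only [mul_def, map_smul])

end HSG

/-! ### Ideals of induced subgraphs -/

namespace SimpleOrientedGraph

theorem card_eq_of_cls_eq {G H : SimpleOrientedGraph} (h : G.cls = H.cls) :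
    Nat.card G.V = Nat.card H.V :=
  (Quotient.exact h).elim fun e => Nat.card_congr e.toEquiv

theorem isEmpty_iff_of_cls_eq {G H : SimpleOrientedGraph} (h : G.cls = H.cls) :
    IsEmpty G.V ↔ IsEmpty H.V :=
  (Quotient.exact h).elim fun e => e.toEquiv.isEmpty_congr

theorem cls_eq_empty (G : SimpleOrientedGraph) [IsEmpty G.V] : G.cls = empty.cls :=
  Quotient.sound ⟨⟨(Equiv.equivEmpty G.V), fun {x} => isEmptyElim x⟩⟩

theorem cls_sub_sub (G : SimpleOrientedGraph) (S T : Set G.V) (W : Set (G.sub S).V)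
    (h : ∀ x, x ∈ T ↔ ∃ hx : x ∈ S, (⟨x, hx⟩ : S) ∈ W) :
    ((G.sub S).sub W).cls = (G.sub T).cls :=
  Quotient.sound ⟨⟨⟨fun x => ⟨x.1.1, (h _).2 ⟨x.1.2, x.2⟩⟩,
    fun y => ⟨⟨y.1, ((h _).1 y.2).1⟩, ((h _).1 y.2).2⟩, fun _ => rfl, fun _ => rfl⟩, Iff.rfl⟩⟩

theorem cls_sub_univ (G : SimpleOrientedGraph) : (G.sub Set.univ).cls = G.cls :=
  Quotient.sound ⟨⟨Equiv.Set.univ G.V, Iff.rfl⟩⟩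

open Classical in
-- An ideal `W` of the complement of `J` corresponds to `J ∪ W`: an edge leaving `W` ends either in
-- `J` or, by closure, in `W`.
theorem sum_ideals_sub_compl {M : Type*} [AddCommMonoid M] (G : SimpleOrientedGraph) {J : Set G.V}
    {_ : Fintype (Set (G.sub Jᶜ).V)} (hJ : G.rigid.IsIdeal J) (f : Set (G.sub Jᶜ).V → M) :
    ∑ W with (G.sub Jᶜ).rigid.IsIdeal W, f W =
      ∑ J' : Set G.V with G.rigid.IsIdeal J' ∧ J ⊆ J', f (Subtype.val ⁻¹' J') := by
  symm
  refine Finset.sum_bij (fun J' _ => (Subtype.val ⁻¹' J' : Set (G.sub Jᶜ).V)) ?_ ?_ ?_ ?_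
  · intro J' h
    simp only [Finset.mem_filter, Finset.mem_univ, true_and] at h ⊢
    exact fun x y hx hxy => h.1 _ _ hx hxy
  · intro J₁ h₁ J₂ h₂ h
    simp only [Finset.mem_filter, Finset.mem_univ, true_and] at h₁ h₂
    ext x
    by_cases hx : x ∈ J
    · exact ⟨fun _ => h₂.2 hx, fun _ => h₁.2 hx⟩
    · exact Set.ext_iff.1 h ⟨x, hx⟩
  · intro W hW
    simp only [Finset.mem_filter, Finset.mem_univ, true_and] at hW
    refine ⟨J ∪ Subtype.val '' W, ?_, ?_⟩
    · simp only [Finset.mem_filter, Finset.mem_univ, true_and]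
      refine ⟨?_, Set.subset_union_left⟩
      rintro x y (hx | ⟨x, hx, rfl⟩) hxy
      · exact Or.inl (hJ x y hx hxy)
      · by_cases hy : y ∈ J
        · exact Or.inl hy
        · exact Or.inr ⟨⟨y, hy⟩, hW x ⟨y, hy⟩ hx hxy, rfl⟩
    · ext x
      refine ⟨?_, fun h => Or.inr ⟨x, h, rfl⟩⟩
      rintro (h | ⟨y, hy, h⟩)
      · exact absurd h x.2
      · rwa [← Subtype.ext h]
  · exact fun _ _ => rfl

open Classical in
theorem sum_ideals_sub {M : Type*} [AddCommMonoid M] (G : SimpleOrientedGraph) {J : Set G.V}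
    {_ : Fintype (Set (G.sub J).V)} (hJ : G.rigid.IsIdeal J) (f : Set (G.sub J).V → M) :
    ∑ W with (G.sub J).rigid.IsIdeal W, f W =
      ∑ J' : Set G.V with G.rigid.IsIdeal J' ∧ J' ⊆ J, f (Subtype.val ⁻¹' J') := by
  symm
  refine Finset.sum_bij (fun J' _ => (Subtype.val ⁻¹' J' : Set (G.sub J).V)) ?_ ?_ ?_ ?_
  · intro J' h
    simp only [Finset.mem_filter, Finset.mem_univ, true_and] at h ⊢
    exact fun x y hx hxy => h.1 _ _ hx hxy
  · intro J₁ h₁ J₂ h₂ h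
    simp only [Finset.mem_filter, Finset.mem_univ, true_and] at h₁ h₂
    ext x
    by_cases hx : x ∈ J
    · exact Set.ext_iff.1 h ⟨x, hx⟩
    · exact ⟨fun h => absurd (h₁.2 h) hx, fun h => absurd (h₂.2 h) hx⟩
  · intro W hW
    simp only [Finset.mem_filter, Finset.mem_univ, true_and] at hW
    refine ⟨Subtype.val '' W, ?_, ?_⟩
    · simp only [Finset.mem_filter, Finset.mem_univ, true_and]
      refine ⟨?_, fun _ ⟨x, _, h⟩ => h ▸ x.2⟩
      rintro _ y ⟨x, hx, rfl⟩ hxy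
      exact ⟨⟨y, hJ x y x.2 hxy⟩, hW x ⟨y, hJ x y x.2 hxy⟩ hx hxy, rfl⟩
    · exact Set.preimage_image_eq _ Subtype.val_injective
  · exact fun _ _ => rfl

end SimpleOrientedGraph

/-! ### Ideals of merged graphs and saturated sets -/

namespace MergeGraph

/-- The sets of vertices which are unions of classes. -/
def IsSaturated (P : MergeGraph) (s : Setoid P.V) (J : Set P.V) : Prop :=
  ∀ x y, s x y → x ∈ J → y ∈ J

theorem IsSaturated.compl {P : MergeGraph} {s : Setoid P.V} {J : Set P.V}
    (h : P.IsSaturated s J) : P.IsSaturated s Jᶜ :=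
  fun x y hxy hx hy => hx (h y x (s.symm hxy) hy)

theorem IsSaturated.preimage_image {P : MergeGraph} {s : Setoid P.V} {J : Set P.V}
    (h : P.IsSaturated s J) : P.proj s ⁻¹' (P.proj s '' J) = J := by
  refine Set.Subset.antisymm ?_ (Set.subset_preimage_image _ _)
  rintro x ⟨y, hy, hxy⟩
  exact h y x ((P.proj_eq_iff s y x).1 hxy) hy

theorem isSaturated_preimage (P : MergeGraph) (s : Setoid P.V) (I : Set (P.quot s).V) :
    P.IsSaturated s (P.proj s ⁻¹' I) := by
  intro x y h hx
  rwa [Set.mem_preimage, ← (P.proj_eq_iff s x y).2 h]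

theorem cls_quot_sub (P : MergeGraph) (s : Setoid P.V) (I : Set (P.quot s).V) :
    ((P.quot s).sub I).cls = ((P.sub (P.proj s ⁻¹' I)).quot (s.comap Subtype.val)).cls := by
  symm
  refine cls_quot_eq _ _ _ (fun x => ⟨P.proj s x.1, x.2⟩) ?_ ?_ ?_
  · rintro ⟨y, hy⟩
    obtain ⟨x, rfl⟩ := P.proj_surjective s y
    exact ⟨⟨x, hy⟩, rfl⟩
  · intro x y
    rw [Subtype.mk.injEq, P.proj_eq_iff]
    rfl
  · intro u v
    change (P.quot s).graph.Adj u.1 v.1 ↔ _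
    rw [quot_adj, Ne, Ne, Subtype.ext_iff]
    refine and_congr_right fun _ => ⟨?_, ?_⟩
    · rintro ⟨x, y, h, hx, hy⟩
      exact ⟨⟨x, by rw [Set.mem_preimage, hx]; exact u.2⟩,
        ⟨y, by rw [Set.mem_preimage, hy]; exact v.2⟩, h, Subtype.ext hx, Subtype.ext hy⟩
    · rintro ⟨x, y, h, rfl, rfl⟩
      exact ⟨x, y, h, rfl, rfl⟩

/-- An edge inside a class leaves no trace in the quotient, but saturation of the preimage takes
care of it. -/
theorem IsIdeal.preimage {P : MergeGraph} {s : Setoid P.V} {I : Set (P.quot s).V}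
    (hI : (P.quot s).rigid.IsIdeal I) : P.IsIdeal (P.proj s ⁻¹' I) := by
  intro x y hx hxy
  by_cases h : s x y
  · exact P.isSaturated_preimage s I x y h hx
  · exact hI _ _ hx (P.quot_adj_proj s hxy h)

theorem IsIdeal.image {P : MergeGraph} {s : Setoid P.V} {J : Set P.V}
    (hJ : P.IsIdeal J) (hs : P.IsSaturated s J) :
    (P.quot s).rigid.IsIdeal (P.proj s '' J) := by
  rintro _ _ ⟨z, hz, rfl⟩ ⟨_, x, y, h, hx, rfl⟩
  exact ⟨y, hJ x y (hs z x ((P.proj_eq_iff s z x).1 hx.symm) hz) h, rfl⟩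

open Classical in
theorem sum_ideals_quot {M : Type*} [AddCommMonoid M] (P : MergeGraph) (s : Setoid P.V)
    (f : Set P.V → M) :
    ∑ I with (P.quot s).rigid.IsIdeal I, f (P.proj s ⁻¹' I) =
      ∑ J with P.IsIdeal J ∧ P.IsSaturated s J, f J := by
  refine Finset.sum_bij (fun I _ => P.proj s ⁻¹' I) ?_ ?_ ?_ ?_
  · intro I hI
    simp only [Finset.mem_filter, Finset.mem_univ, true_and] at hI ⊢
    exact ⟨hI.preimage, P.isSaturated_preimage s I⟩
  · intro I _ I' _ h
    exact (P.proj_surjective s).preimage_injective h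
  · intro J hJ
    simp only [Finset.mem_filter, Finset.mem_univ, true_and] at hJ
    exact ⟨P.proj s '' J, by simpa using hJ.1.image hJ.2, hJ.2.preimage_image⟩
  · exact fun _ _ => rfl

/-- No class straddles `J` and its complement; this makes the powers of `q` split along a cut. -/
theorem IsSaturated.card_quot {P : MergeGraph} {s : Setoid P.V} {J : Set P.V}
    (h : P.IsSaturated s J) :
    Nat.card (Quotient s) =
      Nat.card (Quotient (s.comap Subtype.val : Setoid (P.sub Jᶜ).V)) +
      Nat.card (Quotient (s.comap Subtype.val : Setoid (P.sub J).V)) := by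
  classical
  obtain ⟨I, rfl⟩ : ∃ I, P.proj s ⁻¹' I = J := ⟨_, h.preimage_image⟩
  have h1 := card_eq_of_cls_eq (P.cls_quot_sub s I)
  have h2 := card_eq_of_cls_eq (P.cls_quot_sub s Iᶜ)
  rw [MergeGraph.card_quot, MergeGraph.card_quot, MergeGraph.card_quot]
  rw [Set.preimage_compl] at h2
  rw [← h1, ← h2, add_comm]
  exact (Set.ncard_add_ncard_compl I).symm

/-- The equivalence restricting to given ones on a set of vertices and on its complement. -/
def joinSetoid (P : MergeGraph) (J : Set P.V) (s₁ : Setoid (Jᶜ : Set P.V)) (s₂ : Setoid J) :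
    Setoid P.V where
  r x y := (∃ (hx : x ∈ Jᶜ) (hy : y ∈ Jᶜ), s₁ ⟨x, hx⟩ ⟨y, hy⟩) ∨
    ∃ (hx : x ∈ J) (hy : y ∈ J), s₂ ⟨x, hx⟩ ⟨y, hy⟩
  iseqv := by
    refine ⟨fun x => ?_, ?_, ?_⟩
    · by_cases hx : x ∈ J
      · exact Or.inr ⟨hx, hx, s₂.refl _⟩
      · exact Or.inl ⟨hx, hx, s₁.refl _⟩
    · rintro x y (⟨hx, hy, h⟩ | ⟨hx, hy, h⟩)
      · exact Or.inl ⟨hy, hx, s₁.symm h⟩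
      · exact Or.inr ⟨hy, hx, s₂.symm h⟩
    · rintro x y z (⟨hx, hy, h⟩ | ⟨hx, hy, h⟩) (⟨hy', hz, h'⟩ | ⟨hy', hz, h'⟩)
      · exact Or.inl ⟨hx, hz, s₁.trans h h'⟩
      · exact absurd hy' hy
      · exact absurd hy hy'
      · exact Or.inr ⟨hx, hz, s₂.trans h h'⟩

open Classical in
-- An equivalence that saturates `J` links nothing in `J` to anything outside, so it is determined
-- by its two restrictions, which are arbitrary.
theorem sum_saturated {M : Type*} [AddCommMonoid M] (P : MergeGraph) (J : Set P.V)
    {_ : Fintype (Setoid (P.sub Jᶜ).V)} {_ : Fintype (Setoid (P.sub J).V)}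
    (f : Setoid (P.sub Jᶜ).V → Setoid (P.sub J).V → M) :
    ∑ s with P.IsMerge s ∧ P.IsSaturated s J, f (s.comap Subtype.val) (s.comap Subtype.val) =
      ∑ s₁ with (P.sub Jᶜ).IsMerge s₁, ∑ s₂ with (P.sub J).IsMerge s₂, f s₁ s₂ := by
  rw [← Finset.sum_product']
  refine Finset.sum_bij (fun s _ => (s.comap Subtype.val, s.comap Subtype.val)) ?_ ?_ ?_ ?_
  · intro s hs
    simp only [Finset.mem_filter, Finset.mem_univ, true_and, Finset.mem_product] at hs ⊢
    exact ⟨fun x y h h' => Subtype.ext (hs.1 _ _ h h'), fun x y h h' => Subtype.ext (hs.1 _ _ h h')⟩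
  · intro s hs t ht h
    simp only [Finset.mem_filter, Finset.mem_univ, true_and] at hs ht
    obtain ⟨h₁, h₂⟩ := Prod.ext_iff.1 h
    ext x y
    by_cases hx : x ∈ J
    · by_cases hy : y ∈ J
      · exact Setoid.ext_iff.1 h₂ ⟨x, hx⟩ ⟨y, hy⟩
      · exact ⟨fun h => absurd (hs.2 x y h hx) hy, fun h => absurd (ht.2 x y h hx) hy⟩
    · by_cases hy : y ∈ J
      · exact ⟨fun h => absurd (hs.2 y x (s.symm h) hy) hx,
          fun h => absurd (ht.2 y x (t.symm h) hy) hx⟩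
      · exact Setoid.ext_iff.1 h₁ ⟨x, hx⟩ ⟨y, hy⟩
  · rintro ⟨s₁, s₂⟩ hs
    simp only [Finset.mem_filter, Finset.mem_univ, true_and, Finset.mem_product] at hs
    refine ⟨P.joinSetoid J s₁ s₂, ?_, Prod.ext ?_ ?_⟩
    · simp only [Finset.mem_filter, Finset.mem_univ, true_and]
      refine ⟨?_, ?_⟩
      · rintro x y h (⟨hx, hy, hxy⟩ | ⟨hx, hy, hxy⟩)
        · exact congrArg Subtype.val (hs.1 _ _ h hxy)
        · exact congrArg Subtype.val (hs.2 _ _ h hxy)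
      · rintro x y (⟨hx, hy, hxy⟩ | ⟨hx, hy, hxy⟩) h
        · exact absurd h hx
        · exact hy
    · ext x y
      refine ⟨?_, fun h => Or.inl ⟨x.2, y.2, h⟩⟩
      rintro (⟨_, _, h⟩ | ⟨h, _⟩)
      · exact h
      · exact absurd h x.2
    · ext x y
      refine ⟨?_, fun h => Or.inr ⟨x.2, y.2, h⟩⟩
      rintro (⟨h, _⟩ | ⟨_, _, h⟩)
      · exact absurd x.2 h
      · exact h
  · exact fun _ _ => rfl

end MergeGraph

/-! ### The coproduct, the counit and the bialgebra structure -/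

namespace HSG

open MergeGraph

variable {K : Type u} [Field K] (q : K)

open Classical in
/-- The sum over all ways of cutting along an ideal. -/
noncomputable def cuts (P : MergeGraph) : HSG K q ⊗[K] HSG K q :=
  ∑ J : Set P.V with P.IsIdeal J, merges q (P.sub Jᶜ) ⊗ₜ[K] merges q (P.sub J)

theorem merges_sub_congr {P Q : MergeGraph} (e : P.V ≃ Q.V)
    (hadj : ∀ x y, Q.adj (e x) (e y) ↔ P.adj x y) (hsep : ∀ x y, Q.sep (e x) (e y) ↔ P.sep x y)
    (J : Set Q.V) : merges q (P.sub (e ⁻¹' J)) = merges q (Q.sub J) :=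
  merges_congr q (e.subtypeEquiv fun _ => Iff.rfl) (fun _ _ => hadj _ _) (fun _ _ => hsep _ _)

open Classical in
theorem cuts_congr {P Q : MergeGraph} (e : P.V ≃ Q.V)
    (hadj : ∀ x y, Q.adj (e x) (e y) ↔ P.adj x y) (hsep : ∀ x y, Q.sep (e x) (e y) ↔ P.sep x y) :
    cuts q P = cuts q Q := by
  symm
  refine Finset.sum_bij (fun J _ => e ⁻¹' J) ?_ ?_ ?_ ?_
  · intro J hJ
    simp only [Finset.mem_filter, Finset.mem_univ, true_and] at hJ ⊢
    exact fun x y hx hxy => hJ _ _ hx ((hadj x y).2 hxy)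
  · intro J _ J' _ h
    exact e.surjective.preimage_injective h
  · intro J hJ
    simp only [Finset.mem_filter, Finset.mem_univ, true_and] at hJ
    refine ⟨e.symm ⁻¹' J, ?_, by ext; simp⟩
    simp only [Finset.mem_filter, Finset.mem_univ, true_and]
    exact fun x y hx hxy => hJ _ _ hx ((hadj _ _).1 (by simpa using hxy))
  · intro J _
    rw [← Set.preimage_compl, merges_sub_congr q e hadj hsep, merges_sub_congr q e hadj hsep]

open Classical in
theorem cuts_rigid (G : SimpleOrientedGraph) :
    cuts q G.rigid = ∑ J : Set G.V with G.rigid.IsIdeal J,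
      basis q (G.sub Jᶜ).cls ⊗ₜ[K] basis q (G.sub J).cls := by
  refine Finset.sum_congr rfl fun J _ => ?_
  congr 1 <;> exact merges_rigid_congr q _ (Equiv.refl _) (fun _ _ => Iff.rfl) fun _ _ => trivial

/-- The coproduct. -/
noncomputable def comulLin : HSG K q →ₗ[K] HSG K q ⊗[K] HSG K q :=
  (basis q).constr K fun g => cuts q g.out.rigid

theorem comulLin_basis (G : SimpleOrientedGraph) :
    comulLin q (basis q G.cls) = cuts q G.rigid := by
  rw [comulLin, Module.Basis.constr_basis]
  obtain ⟨e⟩ := exists_iso_out G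
  exact (cuts_congr q e.toEquiv (fun _ _ => e.map_rel_iff) fun _ _ => Iff.rfl).symm

open Classical in
-- Both sides run over pairs of an allowed equivalence `s` and an ideal `J` saturated for it.
-- Cutting `P/s` chooses `s` first; once the sums are exchanged, `s` splits into equivalences on the
-- two sides of `J`.
theorem comulLin_merges (P : MergeGraph) : comulLin q (merges q P) = cuts q P := by
  have h1 : comulLin q (merges q P) = ∑ s with P.IsMerge s,
      ∑ J with P.IsIdeal J ∧ P.IsSaturated s J,
        (q ^ (Nat.card (P.sub Jᶜ).V -
            Nat.card (Quotient (s.comap Subtype.val : Setoid (P.sub Jᶜ).V))) •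
          basis q ((P.sub Jᶜ).quot (s.comap Subtype.val)).cls) ⊗ₜ[K]
        (q ^ (Nat.card (P.sub J).V -
            Nat.card (Quotient (s.comap Subtype.val : Setoid (P.sub J).V))) •
          basis q ((P.sub J).quot (s.comap Subtype.val)).cls) := by
    rw [merges, map_sum]
    refine Finset.sum_congr rfl fun s _ => ?_
    rw [map_smul, comulLin_basis, cuts_rigid, Finset.smul_sum, ← sum_ideals_quot]
    refine Finset.sum_congr rfl fun I _ => ?_
    rw [cls_quot_sub, cls_quot_sub, Set.preimage_compl, TensorProduct.smul_tmul_smul, ← pow_add]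
    congr 2
    have h2 := (P.isSaturated_preimage s I).card_quot
    have h3 := card_quot_le (P.sub (P.proj s ⁻¹' I)) (s.comap Subtype.val)
    have h4 := card_quot_le (P.sub (P.proj s ⁻¹' I)ᶜ) (s.comap Subtype.val)
    have h5 : Nat.card (P.sub (P.proj s ⁻¹' I)).V + Nat.card (P.sub (P.proj s ⁻¹' I)ᶜ).V =
      Nat.card P.V := Set.ncard_add_ncard_compl _
    rw [← card_quot] at h3 h4
    omega
  rw [h1, Finset.sum_comm' (t' := Finset.univ.filter fun J => P.IsIdeal J)
    (s' := fun J => Finset.univ.filter fun s => P.IsMerge s ∧ P.IsSaturated s J)]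
  · refine Finset.sum_congr rfl fun J _ => ?_
    rw [merges, merges, TensorProduct.sum_tmul]
    simp only [TensorProduct.tmul_sum]
    exact sum_saturated P J fun s₁ s₂ =>
      (q ^ (Nat.card (P.sub Jᶜ).V - Nat.card (Quotient s₁)) •
          basis q ((P.sub Jᶜ).quot s₁).cls) ⊗ₜ[K]
        (q ^ (Nat.card (P.sub J).V - Nat.card (Quotient s₂)) • basis q ((P.sub J).quot s₂).cls)
  · intro s J
    simp only [Finset.mem_filter, Finset.mem_univ, true_and]
    tauto

open Classical in
-- An ideal of a disjoint union is a pair of ideals, and each half of the cut is again a disjoint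
-- union, to which `merges_mul_merges` applies.
theorem cuts_sum (P Q : MergeGraph) : cuts q (P.sum Q) = cuts q P * cuts q Q := by
  simp only [cuts, Finset.sum_mul_sum, Algebra.TensorProduct.tmul_mul_tmul, merges_mul_merges]
  rw [← Finset.sum_product']
  refine Finset.sum_bij (fun J _ => (Sum.inl ⁻¹' J, Sum.inr ⁻¹' J)) ?_ ?_ ?_ ?_
  · intro J hJ
    simp only [Finset.mem_filter, Finset.mem_univ, true_and, Finset.mem_product] at hJ ⊢
    exact ⟨fun x y hx h => hJ _ _ hx (.inl h), fun x y hx h => hJ _ _ hx (.inr h)⟩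
  · intro J _ J' _ h
    obtain ⟨h₁, h₂⟩ := Prod.ext_iff.1 h
    ext (x | x)
    · exact Set.ext_iff.1 h₁ x
    · exact Set.ext_iff.1 h₂ x
  · rintro ⟨J₁, J₂⟩ hJ
    simp only [Finset.mem_filter, Finset.mem_univ, true_and, Finset.mem_product] at hJ
    refine ⟨Sum.inl '' J₁ ∪ Sum.inr '' J₂, ?_, by ext <;> simp⟩
    simp only [Finset.mem_filter, Finset.mem_univ, true_and]
    rintro _ _ hx (h | h)
    · exact Or.inl ⟨_, hJ.1 _ _ (by simpa using hx) h, rfl⟩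
    · exact Or.inr ⟨_, hJ.2 _ _ (by simpa using hx) h, rfl⟩
  · intro J _
    have key : ∀ J : Set (P.sum Q).V, merges q ((P.sum Q).sub J) =
        merges q ((P.sub (Sum.inl ⁻¹' J)).sum (Q.sub (Sum.inr ⁻¹' J))) := fun J =>
      merges_congr q (Equiv.subtypeSum (p := fun x => x ∈ J))
        (by rintro ⟨x | x, hx⟩ ⟨y | y, hy⟩ <;> simp [Equiv.subtypeSum])
        (by rintro ⟨x | x, hx⟩ ⟨y | y, hy⟩ <;> simp [Equiv.subtypeSum])
    rw [key, key, Set.preimage_compl, Set.preimage_compl]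

theorem comulLin_mul (x y : HSG K q) : comulLin q (x * y) = comulLin q x * comulLin q y := by
  have : (LinearMap.mul K (HSG K q)).compr₂ (comulLin q) =
      (LinearMap.mul K (HSG K q ⊗[K] HSG K q)).compl₁₂ (comulLin q) (comulLin q) := by
    refine linearMap_ext q fun G => linearMap_ext q fun H => ?_
    simp only [LinearMap.compr₂_apply, LinearMap.mul_apply', LinearMap.compl₁₂_apply]
    rw [basis_mul_basis, comulLin_merges, cuts_sum, comulLin_basis, comulLin_basis]
  exact LinearMap.congr_fun₂ this x y

open Classical in
/-- The counit. -/
noncomputable def counitLin : HSG K q →ₗ[K] K :=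
  (basis q).constr K fun g => if IsEmpty g.out.V then 1 else 0

open Classical in
theorem counitLin_basis (G : SimpleOrientedGraph) :
    counitLin q (basis q G.cls) = if IsEmpty G.V then 1 else 0 := by
  rw [counitLin, Module.Basis.constr_basis, isEmpty_iff_of_cls_eq (Quotient.out_eq G.cls)]

open Classical in
theorem counitLin_merges (P : MergeGraph) :
    counitLin q (merges q P) = if IsEmpty P.V then 1 else 0 := by
  split_ifs with h
  · rw [merges_rigid_congr q empty (Equiv.equivEmpty P.V) (fun x => isEmptyElim x)
      (fun x => isEmptyElim x), counitLin_basis, if_pos (inferInstanceAs (IsEmpty Empty))]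
  · rw [merges, map_sum]
    refine Finset.sum_eq_zero fun s _ => ?_
    rw [map_smul, counitLin_basis, if_neg, smul_zero]
    exact fun h' => h ⟨fun x => h'.elim (P.proj s x)⟩

theorem counitLin_mul (x y : HSG K q) : counitLin q (x * y) = counitLin q x * counitLin q y := by
  classical
  have : (LinearMap.mul K (HSG K q)).compr₂ (counitLin q) =
      (LinearMap.mul K K).compl₁₂ (counitLin q) (counitLin q) := by
    refine linearMap_ext q fun G => linearMap_ext q fun H => ?_
    simp only [LinearMap.compr₂_apply, LinearMap.mul_apply', LinearMap.compl₁₂_apply]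
    rw [basis_mul_basis, counitLin_merges, counitLin_basis, counitLin_basis, isEmpty_sum,
      ite_zero_mul_ite_zero, mul_one]
    congr
  exact LinearMap.congr_fun₂ this x y

noncomputable instance : CoalgebraStruct K (HSG K q) := ⟨comulLin q, counitLin q⟩

open Classical in
theorem comul_basis (G : SimpleOrientedGraph) :
    Coalgebra.comul (R := K) (basis q G.cls) = ∑ J : Set G.V with G.rigid.IsIdeal J,
      basis q (G.sub Jᶜ).cls ⊗ₜ[K] basis q (G.sub J).cls :=
  (comulLin_basis q G).trans (cuts_rigid q G)

open Classical in
theorem counit_basis (G : SimpleOrientedGraph) :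
    Coalgebra.counit (R := K) (basis q G.cls) = if IsEmpty G.V then 1 else 0 :=
  counitLin_basis q G

open Classical in
theorem counit_basis_sub (G : SimpleOrientedGraph) (J : Set G.V) :
    Coalgebra.counit (R := K) (basis q (G.sub J).cls) = if J = ∅ then 1 else 0 := by
  rw [counit_basis]
  exact if_congr Set.isEmpty_coe_sort rfl rfl

open Coalgebra in
-- Both sides sum over nested ideals `J ⊆ J'`, with factors carried by the complement of `J'`, by
-- `J' \ J` and by `J`.
theorem coassoc_basis (G : SimpleOrientedGraph) :
    TensorProduct.assoc K (HSG K q) (HSG K q) (HSG K q)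
      (comul.rTensor (HSG K q) (comul (R := K) (basis q G.cls))) =
    comul.lTensor (HSG K q) (comul (R := K) (basis q G.cls)) := by
  classical
  have hl : ∀ J : Set G.V, G.rigid.IsIdeal J → comul (R := K) (basis q (G.sub Jᶜ).cls) =
      ∑ J' : Set G.V with G.rigid.IsIdeal J' ∧ J ⊆ J',
        basis q (G.sub J'ᶜ).cls ⊗ₜ[K] basis q (G.sub (J' \ J)).cls := by
    intro J hJ
    rw [comul_basis]
    refine (G.sum_ideals_sub_compl hJ fun W => basis q ((G.sub Jᶜ).sub Wᶜ).cls ⊗ₜ[K]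
      basis q ((G.sub Jᶜ).sub W).cls).trans ?_
    refine Finset.sum_congr rfl fun J' h => ?_
    simp only [Finset.mem_filter, Finset.mem_univ, true_and] at h
    rw [G.cls_sub_sub Jᶜ J'ᶜ, G.cls_sub_sub Jᶜ (J' \ J)]
    · intro x
      simp [and_comm]
    · intro x
      simpa using fun h' h'' => h' (h.2 h'')
  have hr : ∀ J : Set G.V, G.rigid.IsIdeal J → comul (R := K) (basis q (G.sub J).cls) =
      ∑ J' : Set G.V with G.rigid.IsIdeal J' ∧ J' ⊆ J,
        basis q (G.sub (J \ J')).cls ⊗ₜ[K] basis q (G.sub J').cls := by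
    intro J hJ
    rw [comul_basis]
    refine (G.sum_ideals_sub hJ fun W => basis q ((G.sub J).sub Wᶜ).cls ⊗ₜ[K]
      basis q ((G.sub J).sub W).cls).trans ?_
    refine Finset.sum_congr rfl fun J' h => ?_
    simp only [Finset.mem_filter, Finset.mem_univ, true_and] at h
    rw [G.cls_sub_sub J (J \ J'), G.cls_sub_sub J J']
    · intro x
      simpa using fun h' => h.2 h'
    · intro x
      simp
  rw [comul_basis, map_sum, map_sum, map_sum]
  simp only [LinearMap.rTensor_tmul, LinearMap.lTensor_tmul]
  refine (Finset.sum_congr rfl fun J hJ => by rw [hl J (by simpa using hJ)]).trans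
    (Eq.trans ?_ (Finset.sum_congr rfl fun J hJ => by rw [hr J (by simpa using hJ)]).symm)
  simp only [TensorProduct.sum_tmul, TensorProduct.tmul_sum, map_sum, TensorProduct.assoc_tmul]
  refine Finset.sum_comm' fun J J' => ?_
  simp only [Finset.mem_filter, Finset.mem_univ, true_and]
  tauto

open Coalgebra in
noncomputable instance : Coalgebra K (HSG K q) where
  coassoc := linearMap_ext q fun G => coassoc_basis q G
  rTensor_counit_comp_comul := linearMap_ext q fun G => by
    classical
    simp only [LinearMap.comp_apply, comul_basis, map_sum, LinearMap.rTensor_tmul,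
      counit_basis_sub, TensorProduct.mk_apply]
    rw [Finset.sum_eq_single Set.univ]
    · simp [cls_sub_univ]
    · intro J _ hJ
      rw [if_neg (by simpa using hJ), TensorProduct.zero_tmul]
    · intro h
      exact absurd (Finset.mem_filter.2 ⟨Finset.mem_univ _, fun _ _ _ _ => trivial⟩) h
  lTensor_counit_comp_comul := linearMap_ext q fun G => by
    classical
    simp only [LinearMap.comp_apply, comul_basis, map_sum, LinearMap.lTensor_tmul,
      counit_basis_sub, LinearMap.flip_apply, TensorProduct.mk_apply]
    rw [Finset.sum_eq_single ∅]
    · simp [cls_sub_univ]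
    · intro J _ hJ
      rw [if_neg hJ, TensorProduct.tmul_zero]
    · intro h
      exact absurd (Finset.mem_filter.2 ⟨Finset.mem_univ _, fun _ _ h _ => h.elim⟩) h

theorem comul_one' : Coalgebra.comul (R := K) (1 : HSG K q) = 1 := by
  classical
  rw [one_def, comul_basis, Finset.sum_eq_single ∅]
  · have : IsEmpty (empty.sub ∅ᶜ).V := ⟨fun x => nomatch x.1⟩
    have : IsEmpty (empty.sub ∅).V := ⟨fun x => nomatch x.1⟩
    rw [cls_eq_empty, cls_eq_empty (empty.sub ∅)]
    rfl
  · intro J _ hJ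
    exact absurd (Set.eq_empty_of_forall_notMem fun x => nomatch x) hJ
  · intro h
    exact absurd (Finset.mem_filter.2 ⟨Finset.mem_univ _, fun _ _ h _ => h.elim⟩) h

noncomputable instance : Bialgebra K (HSG K q) :=
  Bialgebra.mk' K (HSG K q)
    (by rw [one_def, counit_basis, if_pos (inferInstanceAs (IsEmpty Empty))])
    (counitLin_mul q _ _) (comul_one' q) (comulLin_mul q _ _)

end HSG

/-! ### Cycles under cuts and gluings; equivalences as partial injections -/

namespace SimpleOrientedGraph

theorem NoCycle.of_injective {G H : SimpleOrientedGraph} (hH : H.NoCycle) (f : G.V → H.V)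
    (hf : Function.Injective f) (hadj : ∀ x y, G.graph.Adj x y → H.graph.Adj (f x) (f y)) :
    G.NoCycle :=
  fun n c hc => hH n (f ∘ c) ⟨hf.comp hc.1, fun i => hadj _ _ (hc.2 i)⟩

/-- Following edges from `c i` reaches every `c (i + k)`, and addition of indices is cyclic. -/
theorem IsCycle.mem_ideal {G : SimpleOrientedGraph} {n : ℕ} {c : Fin (n + 2) → G.V}
    (hc : G.IsCycle c) {J : Set G.V} (hJ : G.rigid.IsIdeal J) {i : Fin (n + 2)} (hi : c i ∈ J)
    (j : Fin (n + 2)) : c j ∈ J := by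
  have h : ∀ k : Fin (n + 2), c (i + k) ∈ J := by
    intro k
    induction k using Fin.induction with
    | zero => simpa using hi
    | succ k ih =>
      have := hJ _ _ ih (hc.2 _)
      rwa [add_assoc, Fin.coeSucc_eq_succ] at this
  have := h (j - i)
  rwa [add_sub_cancel] at this

/-- A cycle lies entirely in `J` or entirely outside, so cutting along an ideal never destroys it.
-/
theorem noCycle_of_sub {G : SimpleOrientedGraph} {J : Set G.V} (hJ : G.rigid.IsIdeal J)
    (h₁ : (G.sub Jᶜ).NoCycle) (h₂ : (G.sub J).NoCycle) : G.NoCycle := by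
  intro n c hc
  by_cases h : ∃ i, c i ∈ J
  · obtain ⟨i, hi⟩ := h
    exact h₂ n (fun j => ⟨c j, hc.mem_ideal hJ hi j⟩)
      ⟨fun _ _ h => hc.1 (congrArg Subtype.val h), hc.2⟩
  · exact h₁ n (fun j => ⟨c j, fun hj => h ⟨j, hj⟩⟩)
      ⟨fun _ _ h => hc.1 (congrArg Subtype.val h), hc.2⟩

/-- `G` embeds in each of its gluings: its vertices stay distinct, so none of its edges becomes a
loop. -/
theorem noCycle_of_quot_sum {G H : SimpleOrientedGraph} {s : Setoid (G.rigid.sum H.rigid).V}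
    (hs : (G.rigid.sum H.rigid).IsMerge s) (h : ((G.rigid.sum H.rigid).quot s).NoCycle) :
    G.NoCycle := by
  have hinj : ∀ x y : G.V, s (Sum.inl x) (Sum.inl y) → x = y := fun x y hxy =>
    Sum.inl_injective (hs _ _ (.inl trivial) hxy)
  refine h.of_injective (fun x => (G.rigid.sum H.rigid).proj s (Sum.inl x)) ?_ ?_
  · intro x y hxy
    exact hinj x y (((G.rigid.sum H.rigid).proj_eq_iff s _ _).1 hxy)
  · intro x y hxy
    refine (G.rigid.sum H.rigid).quot_adj_proj s (.inl hxy) fun e => ?_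
    obtain rfl := hinj x y e
    exact G.loopless x hxy

theorem card_sub_le (G : SimpleOrientedGraph) (J : Set G.V) :
    Nat.card (G.sub J).V ≤ Nat.card G.V :=
  Finite.card_subtype_le _

theorem card_sub_compl_lt (G : SimpleOrientedGraph) {J : Set G.V} (hJ : J ≠ ∅) :
    Nat.card (G.sub Jᶜ).V < Nat.card G.V := by
  obtain ⟨x, hx⟩ := Set.nonempty_iff_ne_empty.2 hJ
  exact Finite.card_subtype_lt (p := fun x => x ∈ Jᶜ) (x := x) (fun h => h hx)

theorem glueSetoid_inl_inr (G H : SimpleOrientedGraph) {A : Finset G.V} (σ : A ↪ H.V)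
    (x : G.V) (y : H.V) :
    glueSetoid G H σ (Sum.inl x) (Sum.inr y) ↔ ∃ h : x ∈ A, σ ⟨x, h⟩ = y := by
  constructor
  · rintro (h | ⟨z, hz, hz'⟩ | ⟨z, hz, _⟩)
    · exact nomatch h
    · obtain rfl := Sum.inl_injective hz
      exact ⟨z.2, (Sum.inr_injective hz').symm⟩
    · exact nomatch hz
  · rintro ⟨h, rfl⟩
    exact Or.inr (Or.inl ⟨⟨x, h⟩, rfl, rfl⟩)

theorem isMerge_glueSetoid (G H : SimpleOrientedGraph) {A : Finset G.V} (σ : A ↪ H.V) :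
    (G.rigid.sum H.rigid).IsMerge (glueSetoid G H σ) := by
  rintro _ _ (h | h) (h' | ⟨z, hz, hz'⟩ | ⟨z, hz, hz'⟩)
  · exact h'
  · exact nomatch hz'
  · exact nomatch hz'
  · exact h'
  · exact nomatch hz
  · exact nomatch hz

/-- A vertex of `G` is linked by `s` to at most one vertex of `H`, since those are not merged with
each other. `A` consists of the linked vertices, and `σ` is injective since vertices of `G` are not
merged either. -/
theorem exists_glueSetoid_eq (G H : SimpleOrientedGraph) {s : Setoid (G.V ⊕ H.V)}
    (hs : (G.rigid.sum H.rigid).IsMerge s) :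
    ∃ (A : Finset G.V) (σ : A ↪ H.V), glueSetoid G H σ = s := by
  classical
  have hl : ∀ x y : G.V, s (Sum.inl x) (Sum.inl y) ↔ x = y := fun x y =>
    ⟨fun h => Sum.inl_injective (hs _ _ (.inl trivial) h), fun h => h ▸ s.refl _⟩
  have hr : ∀ x y : H.V, s (Sum.inr x) (Sum.inr y) ↔ x = y := fun x y =>
    ⟨fun h => Sum.inr_injective (hs _ _ (.inr trivial) h), fun h => h ▸ s.refl _⟩
  let A : Finset G.V := Finset.univ.filter fun x => ∃ y, s (Sum.inl x) (Sum.inr y)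
  have hA : ∀ x : A, ∃ y, s (Sum.inl x.1) (Sum.inr y) := fun x => (Finset.mem_filter.1 x.2).2
  choose σ hσ using hA
  have hinj : Function.Injective σ := fun x y h =>
    Subtype.ext ((hl _ _).1 (s.trans (hσ x) (h ▸ s.symm (hσ y))))
  refine ⟨A, ⟨σ, hinj⟩, ?_⟩
  have hlr : ∀ x y, glueSetoid G H ⟨σ, hinj⟩ (Sum.inl x) (Sum.inr y) ↔
      s (Sum.inl x) (Sum.inr y) := by
    intro x y
    rw [glueSetoid_inl_inr]
    constructor
    · rintro ⟨h, rfl⟩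
      exact hσ ⟨x, h⟩
    · intro h
      have hx : x ∈ A := Finset.mem_filter.2 ⟨Finset.mem_univ _, y, h⟩
      exact ⟨hx, (hr _ _).1 (s.trans (s.symm (hσ ⟨x, hx⟩)) h)⟩
  have hm := isMerge_glueSetoid G H ⟨σ, hinj⟩
  ext (x | x) (y | y)
  · rw [hl]
    exact ⟨fun h => Sum.inl_injective (hm _ _ (.inl trivial) h),
      fun h => h ▸ (glueSetoid G H ⟨σ, hinj⟩).refl _⟩
  · exact hlr x y
  · rw [Setoid.comm', hlr, Setoid.comm']
  · rw [hr]
    exact ⟨fun h => Sum.inr_injective (hm _ _ (.inr trivial) h),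
      fun h => h ▸ (glueSetoid G H ⟨σ, hinj⟩).refl _⟩

theorem card_quotient_glueSetoid (G H : SimpleOrientedGraph) {A : Finset G.V} (σ : A ↪ H.V) :
    Nat.card (G.V ⊕ H.V) - Nat.card (Quotient (glueSetoid G H σ)) = A.card := by
  classical
  have hm := isMerge_glueSetoid G H σ
  -- Each class has a unique representative in `H` or in `G` outside `A`.
  let f : {x // x ∉ A} ⊕ H.V → Quotient (glueSetoid G H σ) :=
    Sum.elim (fun x => Quotient.mk _ (Sum.inl x.1)) (fun y => Quotient.mk _ (Sum.inr y))
  have hf : Function.Bijective f := by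
    constructor
    · rintro (x | x) (y | y) h
      · exact congrArg _ (Subtype.ext
          (Sum.inl_injective (hm _ _ (.inl trivial) (Quotient.exact h))))
      · exact absurd ((glueSetoid_inl_inr G H σ _ _).1 (Quotient.exact h)).1 x.2
      · exact absurd ((glueSetoid_inl_inr G H σ _ _).1 (Quotient.exact h.symm)).1 y.2
      · exact congrArg _ (Sum.inr_injective (hm _ _ (.inr trivial) (Quotient.exact h)))
    · rintro ⟨x | y⟩
      · by_cases hx : x ∈ A
        · exact ⟨Sum.inr (σ ⟨x, hx⟩),
            Quotient.sound ((glueSetoid G H σ).symm ((glueSetoid_inl_inr G H σ _ _).2 ⟨hx, rfl⟩))⟩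
        · exact ⟨Sum.inl ⟨x, hx⟩, rfl⟩
      · exact ⟨Sum.inr y, rfl⟩
  have h1 := Nat.card_congr (Equiv.ofBijective f hf)
  have h2 : Nat.card {x // x ∉ A} = Fintype.card G.V - A.card := by
    rw [Nat.card_eq_fintype_card, Fintype.card_subtype_compl, Fintype.card_coe]
  have h3 := A.card_le_univ
  rw [← h1, Nat.card_sum, Nat.card_sum, h2, Nat.card_eq_fintype_card (α := G.V)]
  omega

theorem cls_quot_glueSetoid (G H : SimpleOrientedGraph) {A : Finset G.V} (σ : A ↪ H.V) :
    ((G.rigid.sum H.rigid).quot (glueSetoid G H σ)).cls = (G.glue H σ).cls := by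
  refine MergeGraph.cls_quot_eq _ _ _ (glueProj G H σ) Quotient.mk_surjective
    (fun x y => Quotient.eq) fun u v => and_congr_right fun _ => ⟨?_, ?_⟩
  · rintro (⟨x, y, h, hx, hy⟩ | ⟨x, y, h, hx, hy⟩)
    · exact ⟨_, _, .inl h, hx, hy⟩
    · exact ⟨_, _, .inr h, hx, hy⟩
  · rintro ⟨_, _, h | h, hx, hy⟩
    · exact Or.inl ⟨_, _, h, hx, hy⟩
    · exact Or.inr ⟨_, _, h, hx, hy⟩

theorem cls_restrict (G : SimpleOrientedGraph) (A : Finset G.V) (J : Set G.V)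
    (h : ∀ x, x ∈ A ↔ x ∈ J) : (G.restrict A).cls = (G.sub J).cls :=
  Quotient.sound ⟨⟨Equiv.subtypeEquivRight h, Iff.rfl⟩⟩

end SimpleOrientedGraph

/-! ### The product and coproduct formulas in terms of gluings and restrictions -/

namespace HSG

open MergeGraph

variable {K : Type u} [Field K] (q : K)

open Classical in
theorem basis_mul_basis_eq_glue (G H : SimpleOrientedGraph) :
    basis q G.cls * basis q H.cls =
      ∑ U : Finset G.V, ∑ σ : U ↪ H.V, q ^ U.card • basis q (G.glue H σ).cls := by
  rw [basis_mul_basis, ← Fintype.sum_sigma', merges]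
  symm
  refine Finset.sum_bij (fun p _ => glueSetoid G H p.2) ?_ ?_ ?_ ?_
  · intro p _
    exact Finset.mem_filter.2 ⟨Finset.mem_univ _, isMerge_glueSetoid G H p.2⟩
  · rintro ⟨U, σ⟩ _ ⟨U', σ'⟩ _ h
    have key : ∀ x y, (∃ h : x ∈ U, σ ⟨x, h⟩ = y) ↔ ∃ h : x ∈ U', σ' ⟨x, h⟩ = y := fun x y => by
      rw [← glueSetoid_inl_inr, ← glueSetoid_inl_inr]
      exact Setoid.ext_iff.1 h _ _
    obtain rfl : U = U' := by
      ext x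
      exact ⟨fun hx => ((key x _).1 ⟨hx, rfl⟩).1, fun hx => ((key x _).2 ⟨hx, rfl⟩).1⟩
    congr 1
    ext x
    exact ((key x _).1 ⟨x.2, rfl⟩).2.symm
  · intro s hs
    obtain ⟨U, σ, h⟩ := exists_glueSetoid_eq G H (Finset.mem_filter.1 hs).2
    exact ⟨⟨U, σ⟩, Finset.mem_univ _, h⟩
  · rintro ⟨U, σ⟩ _
    rw [cls_quot_glueSetoid]
    congr 2
    exact (card_quotient_glueSetoid G H σ).symm

open Classical in
theorem comul_basis_eq_restrict (G : SimpleOrientedGraph) :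
    Coalgebra.comul (R := K) (basis q G.cls) = ∑ U : Finset G.V with G.IsIdeal U,
      basis q (G.restrict Uᶜ).cls ⊗ₜ[K] basis q (G.restrict U).cls := by
  rw [comul_basis]
  symm
  refine Finset.sum_bij (fun U _ => (U : Set G.V)) ?_ ?_ ?_ ?_
  · intro U hU
    exact Finset.mem_filter.2 ⟨Finset.mem_univ _, (Finset.mem_filter.1 hU).2⟩
  · intro U _ U' _ h
    exact Finset.coe_injective h
  · intro J hJ
    refine ⟨Finset.univ.filter (· ∈ J), ?_, by ext; simp⟩
    have := (Finset.mem_filter.1 hJ).2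
    refine Finset.mem_filter.2 ⟨Finset.mem_univ _, fun x y hx h => ?_⟩
    simp only [Finset.mem_filter, Finset.mem_univ, true_and] at hx ⊢
    exact this x y hx h
  · intro U _
    rw [G.cls_restrict U U fun _ => Iff.rfl, G.cls_restrict Uᶜ (U : Set G.V)ᶜ (by simp)]

/-! ### The antipode -/

section Antipode

open WithConv

open Classical in
theorem convMul_basis (f g : WithConv (HSG K q →ₗ[K] HSG K q)) (G : SimpleOrientedGraph) :
    (f * g) (basis q G.cls) = ∑ J : Set G.V with G.rigid.IsIdeal J,
      f (basis q (G.sub Jᶜ).cls) * g (basis q (G.sub J).cls) := by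
  rw [LinearMap.convMul_apply, comul_basis, map_sum, map_sum]
  rfl

theorem convMul_basis_congr {f f' g g' : WithConv (HSG K q →ₗ[K] HSG K q)}
    (G : SimpleOrientedGraph)
    (hf : ∀ H : SimpleOrientedGraph, Nat.card H.V ≤ Nat.card G.V →
      f (basis q H.cls) = f' (basis q H.cls))
    (hg : ∀ H : SimpleOrientedGraph, Nat.card H.V ≤ Nat.card G.V →
      g (basis q H.cls) = g' (basis q H.cls)) :
    (f * g) (basis q G.cls) = (f' * g') (basis q G.cls) := by
  rw [convMul_basis, convMul_basis]
  exact Finset.sum_congr rfl fun J _ => by rw [hf _ (G.card_sub_le _), hg _ (G.card_sub_le _)]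

/-- `ηε - id`, the opposite of the projection onto the span of the nonempty graphs. -/
noncomputable def reduced : WithConv (HSG K q →ₗ[K] HSG K q) := 1 - toConv LinearMap.id

open Classical in
theorem reduced_basis (G : SimpleOrientedGraph) :
    reduced q (basis q G.cls) = (if IsEmpty G.V then 1 else 0) - basis q G.cls := by
  change algebraMap K (HSG K q) (Coalgebra.counit (basis q G.cls)) - basis q G.cls = _
  rw [counit_basis, apply_ite (algebraMap K (HSG K q)), map_one, map_zero]

/-- `reduced` kills the empty graph, so a nonzero term of the `n`-th power would cut `G` into `n`
nonempty pieces. -/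
theorem reduced_pow_basis_eq_zero (n : ℕ) (G : SimpleOrientedGraph) (h : Nat.card G.V < n) :
    (reduced q ^ n) (basis q G.cls) = 0 := by
  classical
  induction n generalizing G with
  | zero => exact absurd h (Nat.not_lt_zero _)
  | succ n ih =>
    rw [pow_succ, convMul_basis]
    refine Finset.sum_eq_zero fun J _ => ?_
    by_cases hJ : J = ∅
    · subst hJ
      have : IsEmpty (G.sub ∅).V := ⟨fun x => x.2⟩
      rw [reduced_basis, if_pos this, cls_eq_empty (G.sub ∅), ← one_def, sub_self, mul_zero]
    · rw [ih, zero_mul]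
      have := G.card_sub_compl_lt hJ
      omega

/-- The antipode: a locally finite geometric series. -/
noncomputable def antipodeLin : HSG K q →ₗ[K] HSG K q :=
  (basis q).constr K fun g =>
    (∑ i ∈ Finset.range (Nat.card g.out.V + 1), reduced q ^ i) (basis q g)

theorem sum_conv_apply (s : Finset ℕ) (f : ℕ → WithConv (HSG K q →ₗ[K] HSG K q)) (x : HSG K q) :
    (∑ i ∈ s, f i) x = ∑ i ∈ s, f i x := by
  classical
  induction s using Finset.induction_on with
  | empty => rfl
  | insert a s ha ih => rw [Finset.sum_insert ha, Finset.sum_insert ha, ← ih]; rfl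

/-- The extra powers vanish, so a single truncation serves all pieces of a given graph at once. -/
theorem antipodeLin_basis (G : SimpleOrientedGraph) {n : ℕ} (h : Nat.card G.V < n) :
    antipodeLin q (basis q G.cls) =
      (∑ i ∈ Finset.range n, reduced q ^ i) (basis q G.cls) := by
  rw [antipodeLin, Module.Basis.constr_basis, sum_conv_apply, sum_conv_apply,
    card_eq_of_cls_eq (Quotient.out_eq G.cls)]
  refine Finset.sum_subset (Finset.range_subset_range.2 h) fun i _ hi => ?_
  rw [Finset.mem_range, not_lt] at hi
  exact reduced_pow_basis_eq_zero q i G hi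

theorem toConv_id : (toConv LinearMap.id : WithConv (HSG K q →ₗ[K] HSG K q)) = 1 - reduced q :=
  (sub_sub_cancel _ _).symm

theorem conv_ext {f g : WithConv (HSG K q →ₗ[K] HSG K q)}
    (h : ∀ G : SimpleOrientedGraph, f (basis q G.cls) = g (basis q G.cls)) : f = g :=
  ofConv_injective (linearMap_ext q h)

theorem one_sub_reduced_pow_basis (G : SimpleOrientedGraph) :
    (1 - reduced q ^ (Nat.card G.V + 1)) (basis q G.cls) =
      (1 : WithConv (HSG K q →ₗ[K] HSG K q)) (basis q G.cls) := by
  change (1 : WithConv (HSG K q →ₗ[K] HSG K q)) (basis q G.cls) -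
    (reduced q ^ (Nat.card G.V + 1)) (basis q G.cls) = _
  rw [reduced_pow_basis_eq_zero q _ G (Nat.lt_add_one _), sub_zero]

/-- With `id = 1 - reduced`, the truncated geometric sum telescopes, and the remaining power
vanishes on `G`. -/
theorem antipodeLin_mul_id : toConv (antipodeLin q) * toConv LinearMap.id = 1 := by
  refine conv_ext q fun G => ?_
  rw [convMul_basis_congr q (f := toConv (antipodeLin q)) (g := toConv LinearMap.id) (f' := ∑ i ∈ Finset.range (Nat.card G.V + 1), reduced q ^ i)
    (g' := 1 - reduced q) G (fun H hH => antipodeLin_basis q H (Nat.lt_succ_of_le hH))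
    (fun H _ => by rw [toConv_id]), geom_sum_mul_neg, one_sub_reduced_pow_basis]

theorem id_mul_antipodeLin : toConv LinearMap.id * toConv (antipodeLin q) = 1 := by
  refine conv_ext q fun G => ?_
  rw [convMul_basis_congr q (f := toConv LinearMap.id) (g := toConv (antipodeLin q)) (g' := ∑ i ∈ Finset.range (Nat.card G.V + 1), reduced q ^ i)
    (f' := 1 - reduced q) G (fun H _ => by rw [toConv_id])
    (fun H hH => antipodeLin_basis q H (Nat.lt_succ_of_le hH)), mul_neg_geom_sum,
    one_sub_reduced_pow_basis]

noncomputable instance : HopfAlgebra K (HSG K q) :=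
  HopfAlgebra.ofConvInverse (antipodeLin q) (antipodeLin_mul_id q) (id_mul_antipodeLin q)

theorem antipode_eq : HopfAlgebra.antipode K (A := HSG K q) = antipodeLin q := rfl

end Antipode

end HSG

/-! ### The Hopf ideal of graphs with a cycle and its quotient -/

namespace HSG

open MergeGraph

variable {K : Type u} [Field K] (q : K)

/-- The span of the graphs with a cycle. -/
noncomputable def cyclicSpan : Submodule K (HSG K q) :=
  Submodule.span K (basis q '' {g | ¬ g.NoCycle})

theorem basis_mem_cyclicSpan {G : SimpleOrientedGraph} (hG : ¬ G.NoCycle) :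
    basis q G.cls ∈ cyclicSpan q :=
  Submodule.subset_span ⟨G.cls, hG, rfl⟩

theorem cyclicSpan_le {W : Submodule K (HSG K q)}
    (h : ∀ G : SimpleOrientedGraph, ¬ G.NoCycle → basis q G.cls ∈ W) : cyclicSpan q ≤ W := by
  refine Submodule.span_le.2 ?_
  rintro _ ⟨g, hg, rfl⟩
  obtain ⟨G, rfl⟩ := Quotient.exists_rep g
  exact h G hg

theorem mul_mem_cyclicSpan (x : HSG K q) {y : HSG K q} (hy : y ∈ cyclicSpan q) :
    x * y ∈ cyclicSpan q := by
  classical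
  induction x using induction_basis with
  | h0 => simp
  | hadd x x' h h' => rw [add_mul]; exact add_mem h h'
  | hsmul c x h => rw [smul_mul_assoc]; exact Submodule.smul_mem _ c h
  | hb H =>
    refine cyclicSpan_le q (W := (cyclicSpan q).comap (LinearMap.mulLeft K (basis q H.cls)))
      (fun G hG => ?_) hy
    rw [Submodule.mem_comap, LinearMap.mulLeft_apply, mul_comm, basis_mul_basis, merges]
    refine Submodule.sum_mem _ fun s hs => Submodule.smul_mem _ _ (basis_mem_cyclicSpan q ?_)
    exact fun h => hG (noCycle_of_quot_sum (Finset.mem_filter.1 hs).2 h)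

/-- The ideal spanned by the graphs with a cycle. -/
noncomputable def cyclicIdeal : Ideal (HSG K q) where
  __ := cyclicSpan q
  smul_mem' x _ hy := mul_mem_cyclicSpan q x hy

theorem mk_basis_eq_zero {G : SimpleOrientedGraph} (hG : ¬ G.NoCycle) :
    Ideal.Quotient.mk (cyclicIdeal q) (basis q G.cls) = 0 :=
  Ideal.Quotient.eq_zero_iff_mem.2 (basis_mem_cyclicSpan q hG)

theorem counit_cyclicSpan : cyclicSpan q ≤ LinearMap.ker (Coalgebra.counit (R := K)) := by
  classical
  refine cyclicSpan_le q fun G hG => ?_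
  rw [LinearMap.mem_ker, counit_basis, if_neg]
  exact fun h => hG fun n c _ => h.elim (c 0)

theorem comul_cyclicSpan : cyclicSpan q ≤ LinearMap.ker
    (TensorProduct.map (cyclicSpan q).mkQ (cyclicSpan q).mkQ ∘ₗ Coalgebra.comul (R := K)) := by
  classical
  refine cyclicSpan_le q fun G hG => ?_
  rw [LinearMap.mem_ker, LinearMap.comp_apply, comul_basis, map_sum]
  refine Finset.sum_eq_zero fun J hJ => ?_
  have hJ := (Finset.mem_filter.1 hJ).2
  have h0 : ∀ H : SimpleOrientedGraph, ¬ H.NoCycle → (cyclicSpan q).mkQ (basis q H.cls) = 0 :=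
    fun H hH => (Submodule.Quotient.mk_eq_zero _).2 (basis_mem_cyclicSpan q hH)
  rw [TensorProduct.map_tmul]
  by_cases h : (G.sub Jᶜ).NoCycle
  · rw [h0 (G.sub J) fun h' => hG (noCycle_of_sub hJ h h'), TensorProduct.tmul_zero]
  · rw [h0 _ h, TensorProduct.zero_tmul]

theorem reduced_cyclicSpan {x : HSG K q} (hx : x ∈ cyclicSpan q) :
    reduced q x ∈ cyclicSpan q := by
  have h : reduced q x = algebraMap K _ (Coalgebra.counit (R := K) x) - x := rfl
  rw [h, LinearMap.mem_ker.1 (counit_cyclicSpan q hx), map_zero, zero_sub]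
  exact neg_mem hx

/-- Every cut of a graph with a cycle has a piece with a cycle, and the span absorbs products. As a
sum of such powers, the antipode preserves the span. -/
theorem reduced_pow_basis_mem (n : ℕ) {G : SimpleOrientedGraph} (hG : ¬ G.NoCycle) :
    (reduced q ^ n) (basis q G.cls) ∈ cyclicSpan q := by
  classical
  induction n generalizing G with
  | zero =>
    rw [pow_zero, LinearMap.convOne_apply,
      LinearMap.mem_ker.1 (counit_cyclicSpan q (basis_mem_cyclicSpan q hG)), map_zero]
    exact zero_mem _
  | succ n ih =>
    rw [pow_succ, convMul_basis]
    refine Submodule.sum_mem _ fun J hJ => ?_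
    by_cases h : (G.sub Jᶜ).NoCycle
    · refine mul_mem_cyclicSpan q _ (reduced_cyclicSpan q (basis_mem_cyclicSpan q ?_))
      exact fun h' => hG (noCycle_of_sub (Finset.mem_filter.1 hJ).2 h h')
    · rw [mul_comm]
      exact mul_mem_cyclicSpan q _ (ih h)

theorem antipode_cyclicSpan :
    cyclicSpan q ≤ (cyclicSpan q).comap (HopfAlgebra.antipode K (A := HSG K q)) := by
  refine cyclicSpan_le q fun G hG => ?_
  rw [Submodule.mem_comap, antipode_eq, antipodeLin_basis q G (Nat.lt_add_one _), sum_conv_apply]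
  exact Submodule.sum_mem _ fun n _ => reduced_pow_basis_mem q n hG

instance : (cyclicIdeal q).IsHopfIdeal K where
  counit_eq_zero _ hx := counit_cyclicSpan q hx
  map_mkQ_comul_eq_zero _ hx := comul_cyclicSpan q hx
  antipode_mem _ hx := antipode_cyclicSpan q hx

theorem mk_comp_basis_linearIndependent : LinearIndependent K
    fun g : NCSGClass => Ideal.Quotient.mk (cyclicIdeal q) (basis q g.1) := by
  refine LinearIndependent.map (f := (Ideal.Quotient.mkₐ K (cyclicIdeal q)).toLinearMap)
    ((basis q).linearIndependent.comp (Subtype.val : NCSGClass → SGClass)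
      Subtype.val_injective) ?_
  have hker : LinearMap.ker (Ideal.Quotient.mkₐ K (cyclicIdeal q)).toLinearMap = cyclicSpan q :=
    Submodule.ext fun x => Ideal.Quotient.eq_zero_iff_mem
  rw [hker, Set.range_comp, cyclicSpan]
  -- The kernel of the projection is spanned by the basis vectors complementary to those considered.
  refine (basis q).linearIndependent.disjoint_span_image (Set.disjoint_left.2 ?_)
  rintro _ ⟨g, rfl⟩ h
  exact h g.2

theorem top_le_span_mk_basis : ⊤ ≤ Submodule.span K (Set.range
    fun g : NCSGClass => Ideal.Quotient.mk (cyclicIdeal q) (basis q g.1)) := by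
  rintro x -
  obtain ⟨x, rfl⟩ := Ideal.Quotient.mk_surjective x
  induction x using induction_basis with
  | h0 => simp
  | hadd x y hx hy => rw [map_add]; exact add_mem hx hy
  | hsmul c x hx => exact Submodule.smul_mem _ c hx
  | hb G =>
    by_cases hG : G.NoCycle
    · exact Submodule.subset_span ⟨G.ncCls hG, rfl⟩
    · rw [mk_basis_eq_zero q hG]
      exact zero_mem _

/-- The basis of the quotient given by the graphs with no cycle. -/
noncomputable def ncBasis : Module.Basis NCSGClass K (HSG K q ⧸ cyclicIdeal q) :=
  Module.Basis.mk (mk_comp_basis_linearIndependent q) (top_le_span_mk_basis q)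

theorem ncBasis_ncCls (G : SimpleOrientedGraph) (hG : G.NoCycle) :
    ncBasis q (G.ncCls hG) = Ideal.Quotient.mk (cyclicIdeal q) (basis q G.cls) :=
  Module.Basis.mk_apply _ _ _

theorem isHSG : IsHSG q (basis (K := K) q) where
  mul := basis_mul_basis_eq_glue q
  comul := comul_basis_eq_restrict q
  one := one_def q
  counit := counit_basis q

/-- The formulas are the images of those in `HSG`: the projection kills exactly the gluings that
have a cycle. -/
theorem isHNCSG : IsHNCSG q (ncBasis (K := K) q) where
  mul G H hG hH := by
    rw [ncBasis_ncCls, ncBasis_ncCls, ← map_mul, basis_mul_basis_eq_glue, map_sum]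
    refine Finset.sum_congr rfl fun U _ => ?_
    rw [map_sum]
    refine Finset.sum_congr rfl fun σ _ => ?_
    rw [← Ideal.Quotient.mkₐ_eq_mk K, map_smul, Ideal.Quotient.mkₐ_eq_mk]
    split_ifs with h
    · rw [ncBasis_ncCls]
    · rw [mk_basis_eq_zero q h, smul_zero]
  comul G hG := by
    simp only [ncBasis_ncCls]
    rw [Bialgebra.Quotient.comul_mk, comul_basis_eq_restrict, map_sum]
    rfl
  one := (ncBasis_ncCls q _ _).symm
  counit G hG := by
    rw [ncBasis_ncCls, Bialgebra.Quotient.counit_mk, counit_basis]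

end HSG

theorem mainTheorem8 {K : Type u} [Field K] (q : K) :
    ∃ (A : Type (max 1 u)) (_ : Ring A) (_ : HopfAlgebra K A) (a : Module.Basis SGClass K A)
      (B : Type (max 1 u)) (_ : Ring B) (_ : HopfAlgebra K B) (b : Module.Basis NCSGClass K B),
      IsHSG q a ∧ IsHNCSG q b ∧
      ∃ T : A →ₐc[K] B,
        (∀ (G : SimpleOrientedGraph) (hG : G.NoCycle), T (a G.cls) = b (G.ncCls hG)) ∧
        (∀ G : SimpleOrientedGraph, ¬ G.NoCycle → T (a G.cls) = 0) ∧
        ∀ x : A, T (HopfAlgebra.antipode K x) = HopfAlgebra.antipode K (T x) :=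
  ⟨HSG K q, inferInstance, inferInstance, HSG.basis q, HSG K q ⧸ HSG.cyclicIdeal q, inferInstance,
    inferInstance, HSG.ncBasis q, HSG.isHSG q, HSG.isHNCSG q,
    Bialgebra.Quotient.mkBialgHom (HSG.cyclicIdeal q),
    fun G hG => (HSG.ncBasis_ncCls q G hG).symm, fun _ hG => HSG.mk_basis_eq_zero q hG,
    -- The antipode of the quotient is by construction the one induced by that of `HSG`.
    fun _ => rfl⟩
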